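/- **Setting.** All manifolds, maps and tensor fields are smooth, and $A\otimes_s B=\tfrac12(A\otimes B+B\otimes A)$; round brackets around indices denote symmetrization with the factor $\tfrac12$. *Null hypersurface data* $\{\mathcal N,\gamma,\boldsymbol\ell,\ell^{(2)},\mathbf Y\}$ consist of an $\mathfrak n$-dimensional manifold $\mathcal N$, a symmetric $(0,2)$-tensor $\gamma$ of signature $(0,+,\dots,+)$, a covector field $\boldsymbol\ell$, a function $\ell^{(2)}$ and a symmetric $(0,2)$-tensor $\mathbf Y$, such that at every $p\in\mathcal N$ the symmetric bilinear form $$\boldsymbol{\mathcal A}((W,a),(Z,b))=\gamma(W,Z)+a\,\boldsymbol\ell(Z)+b\,\boldsymbol\ell(W)+ab\,\ell^{(2)}$$ on $T_p\mathcal N\times\mathbb R$ is non-degenerate. Its inverse $\mathcal A$ splits as $\mathcal A((\boldsymbol\alpha,a),(\boldsymbol\beta,b))=P(\boldsymbol\alpha,\boldsymbol\beta)+a\,n(\boldsymbol\beta)+b\,n(\boldsymbol\alpha)$, which defines a symmetric $(2,0)$-tensor $P$ and a vector field $n$ on $\mathcal N$. Put $\mathbf F=\tfrac12 d\boldsymbol\ell$,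 $\boldsymbol s=\mathbf F(n,\cdot)$, $\mathbf U=\tfrac12\pounds_n\gamma$, and let $\mathring\nabla$ be the unique torsion-free connection on $\mathcal N$ with $$\mathring\nabla_a\gamma_{bc}=-\ell_b\mathrm U_{ac}-\ell_c\mathrm U_{ab},\qquad \mathring\nabla_a\ell_b=\mathrm F_{ab}-\ell^{(2)}\mathrm U_{ab}.$$ The data are *$\{\phi,\zeta\}$-embedded* in an $(\mathfrak n+1)$-dimensional Lorentzian manifold $(\mathcal M,g)$ of signature $(-,+,\dots,+)$ if $\phi:\mathcal N\hookrightarrow\mathcal M$ is an embedding and $\zeta$ is a rigging (a vector field along $\phi(\mathcal N)$, everywhere transverse to it, which we extend to a vector field on a neighbourhood of $\phi(\mathcal N)$) with $$\phi^\star g=\gamma,\quad \phi^\star(g(\zeta,\cdot))=\boldsymbol\ell,\quad \phi^\star(g(\zeta,\zeta))=\ell^{(2)},\quad \tfrac12\phi^\star(\pounds_\zeta g)=\mathbf Y.$$ For a basis $\{\hat e_a\}$ of tangent vectors of $\mathcal N$ let $e_a=\phi_\star\hat e_a$, let $\{\boldsymbol\nu,\boldsymbol\theta^a\}$ be the basis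 dual to $\{\zeta,e_a\}$ (so $\boldsymbol\nu$ is the normal covector of $\phi(\mathcal N)$ with $\boldsymbol\nu(\zeta)=1$), and let $\nu=g^\sharp(\boldsymbol\nu,\cdot)$, $\theta^a=g^\sharp(\boldsymbol\theta^a,\cdot)$. **Theorem.** Let null hypersurface data be $\{\phi,\zeta\}$-embedded in $(\mathcal M,g)$ and let $\eta$ be a vector field on an open neighbourhood of $\phi(\mathcal N)$ that is null and tangent to $\phi(\mathcal N)$ at all points of $\phi(\mathcal N)$. With $\mathcal K=\pounds_\eta g$, define on $\mathcal N$ $$\mathfrak p=\phi^\star(\mathcal K(\zeta,\zeta)),\quad \mathfrak w=\phi^\star(\mathcal K(\zeta,\nu)),\quad \boldsymbol{\mathfrak q}=\phi^\star(\mathcal K(\zeta,\cdot)),\quad \boldsymbol{\mathfrak I}=\tfrac12\phi^\star(\pounds_\zeta\mathcal K).$$ Then there are a smooth vector field $\bar\eta$ and a smooth function $\alpha$ on $\mathcal N$ with $\eta|_{\phi(\mathcal N)}=\phi_\star\bar\eta$ and $\bar\eta=\alpha n$; the function and the vector field $$A_\eta=(\pounds_{\bar\eta}\boldsymbol\ell)(n)-\mathfrak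 w,\qquad X_\eta=\Big(\tfrac12\big(\bar\eta(\ell^{(2)})-\mathfrak p\big)n^a+P^{ab}\big((\pounds_{\bar\eta}\boldsymbol\ell)_b-\mathfrak q_b\big)\Big)\hat e_a$$ on $\mathcal N$ are smooth; and on $\phi(\mathcal N)$, for every basis $\{\hat e_a\}$, $$[\eta,\zeta]=A_\eta\,\zeta+\phi_\star X_\eta,\qquad [\eta,\zeta]=\tfrac12\big(\bar\eta(\ell^{(2)})-\mathfrak p\big)\nu+\big((\pounds_{\bar\eta}\boldsymbol\ell)_a-\mathfrak q_a\big)\theta^a .$$ Moreover, on $\mathcal N$, $$\pounds_{\bar\eta}\mathbf Y=A_\eta\mathbf Y+\boldsymbol\ell\otimes_s dA_\eta+\tfrac12\pounds_{X_\eta}\gamma+\boldsymbol{\mathfrak I},$$ and in fully expanded form $$\pounds_{\bar\eta}\mathrm Y_{bd}=\mathring\nabla_b\mathring\nabla_d\alpha+2\alpha\mathring\nabla_{(b}s_{d)}+2s_{(b}\mathring\nabla_{d)}\alpha+n(\alpha)\mathrm Y_{bd}+\tfrac12\bar\eta(\ell^{(2)})\mathrm U_{bd}-\Big(\mathring\nabla_{(b}\mathfrak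 q_{d)}+\mathfrak w\,\mathrm Y_{bd}+\tfrac{\mathfrak p}{2}\mathrm U_{bd}-\mathfrak I_{bd}\Big).$$ -/

import Mathlib

open Bundle FiberBundle VectorField Module
open scoped Manifold ContDiff Topology

noncomputable section

set_option linter.unusedSectionVars false

/-! ## Tensor fields and Lie derivatives on a manifold -/

section TensorFields

variable {E : Type*} [NormedAddCommGroup E] [NormedSpace ℝ E]
  {H : Type*} [TopologicalSpace H] (I : ModelWithCorners ℝ E H)
  {M : Type*} [TopologicalSpace M] [ChartedSpace H M]

/-- (Rough) vector fields on `M`. -/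
abbrev VecField := Π x : M, TangentSpace I x

/-- (Rough) covector fields on `M`. -/
abbrev CovecField := Π x : M, TangentSpace I x →L[ℝ] ℝ

/-- (Rough) `(0,2)`-tensor fields on `M`. -/
abbrev BilinField := Π x : M, TangentSpace I x →L[ℝ] TangentSpace I x →L[ℝ] ℝ

variable {I} [IsManifold I 1 M]

/-- The vector field `X` is differentiable at `x`. -/
abbrev VecField.DiffAt (X : VecField I (M := M)) (x : M) : Prop := MDiffAt (T% X) x

/-- The vector field `X` is smooth on the set `s`. -/
def VecField.SmoothOn (X : VecField I (M := M)) (s : Set M) : Prop := CMDiff[s] ∞ (T% X)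

/-- The vector field `X` is smooth. -/
def VecField.Smooth (X : VecField I (M := M)) : Prop := CMDiff ∞ (T% X)

/-- The covector field `σ` is differentiable at `x`. -/
def CovecField.DiffAt (σ : CovecField I (M := M)) (x : M) : Prop :=
  MDifferentiableAt I (I.prod 𝓘(ℝ, E →L[ℝ] ℝ))
    (fun y ↦ TotalSpace.mk' (E →L[ℝ] ℝ) (E := fun y : M ↦ TangentSpace I y →L[ℝ] ℝ) y (σ y)) x

/-- The covector field `σ` is smooth. -/
def CovecField.Smooth (σ : CovecField I (M := M)) : Prop :=
  ContMDiff I (I.prod 𝓘(ℝ, E →L[ℝ] ℝ)) ∞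
    (fun y ↦ TotalSpace.mk' (E →L[ℝ] ℝ) (E := fun y : M ↦ TangentSpace I y →L[ℝ] ℝ) y (σ y))

/-- The `(0,2)`-tensor field `T` is differentiable at `x`. -/
def BilinField.DiffAt (T : BilinField I (M := M)) (x : M) : Prop :=
  MDifferentiableAt I (I.prod 𝓘(ℝ, E →L[ℝ] E →L[ℝ] ℝ))
    (fun y ↦ TotalSpace.mk' (E →L[ℝ] E →L[ℝ] ℝ)
      (E := fun y : M ↦ TangentSpace I y →L[ℝ] TangentSpace I y →L[ℝ] ℝ) y (T y)) x

/-- The `(0,2)`-tensor field `T` is smooth. -/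
def BilinField.Smooth (T : BilinField I (M := M)) : Prop :=
  ContMDiff I (I.prod 𝓘(ℝ, E →L[ℝ] E →L[ℝ] ℝ)) ∞
    (fun y ↦ TotalSpace.mk' (E →L[ℝ] E →L[ℝ] ℝ)
      (E := fun y : M ↦ TangentSpace I y →L[ℝ] TangentSpace I y →L[ℝ] ℝ) y (T y))

lemma CovecField.DiffAt.apply {σ : CovecField I (M := M)} {X : VecField I (M := M)} {x : M}
    (hσ : CovecField.DiffAt σ x) (hX : MDiffAt (T% X) x) : MDiffAt (fun y ↦ σ y (X y)) x := by
  have : MDifferentiableAt I (I.prod 𝓘(ℝ))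
      (fun m ↦ TotalSpace.mk' ℝ (E := Bundle.Trivial M ℝ) m (σ m (X m))) x :=
    MDifferentiableAt.clm_bundle_apply (F₁ := E) (b := fun y : M ↦ y) hσ hX
  simp only [mdifferentiableAt_totalSpace] at this
  exact this.2

lemma BilinField.DiffAt.apply {T : BilinField I (M := M)} {X : VecField I (M := M)} {x : M}
    (hT : BilinField.DiffAt T x) (hX : MDiffAt (T% X) x) :
    CovecField.DiffAt (fun y ↦ T y (X y)) x :=
  MDifferentiableAt.clm_bundle_apply (F₁ := E) (b := fun y : M ↦ y)
    (E₂ := fun y : M ↦ TangentSpace I y →L[ℝ] ℝ) hT hX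

end TensorFields

section LieDerivatives

variable {E : Type*} [NormedAddCommGroup E] [NormedSpace ℝ E] [FiniteDimensional ℝ E]
  {H : Type*} [TopologicalSpace H] {I : ModelWithCorners ℝ E H}
  {M : Type*} [TopologicalSpace M] [ChartedSpace H M] [IsManifold I ∞ M]

/-- `V(σ(X)) - σ([V,X])` at the point `x`. -/
def lieCovecAux (V : VecField I (M := M)) (σ : CovecField I (M := M)) (x : M)
    (X : VecField I (M := M)) : ℝ :=
  d% (fun y ↦ σ y (X y)) x (V x) - σ x (mlieBracket I V X x)

lemma lieCovecAux_tensorial {V : VecField I (M := M)} {σ : CovecField I (M := M)} {x : M}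
    (hσ : CovecField.DiffAt σ x) : TensorialAt I E (lieCovecAux V σ x) x where
  smul {f X} hf hX := by
    have := FiniteDimensional.complete ℝ E
    have h := mvfderiv_fun_mul hf (hσ.apply hX)
    simp [lieCovecAux, mlieBracket_smul_right hf hX, h]
    ring
  add {X X'} hX hX' := by
    have := FiniteDimensional.complete ℝ E
    have h := mvfderiv_fun_add (hσ.apply hX) (hσ.apply hX')
    simp [lieCovecAux, mlieBracket_add_right hX hX', h]
    ring

open Classical in
/-- The Lie derivative `£_V σ` of a covector field, `(£_V σ)(X) = V(σ(X)) - σ([V,X])`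
(set to `0` at points where `σ` is not differentiable). -/
def lieCovec (V : VecField I (M := M)) (σ : CovecField I (M := M)) : CovecField I (M := M) :=
  fun x ↦ if hσ : CovecField.DiffAt σ x then
    TensorialAt.mkHom (lieCovecAux V σ x) x (lieCovecAux_tensorial hσ) else 0

lemma lieCovec_apply {V : VecField I (M := M)} {σ : CovecField I (M := M)} {x : M}
    (hσ : CovecField.DiffAt σ x) {X : VecField I (M := M)} (hX : VecField.DiffAt X x) :
    lieCovec V σ x (X x) = d% (fun y ↦ σ y (X y)) x (V x) - σ x (mlieBracket I V X x) := by
  simp only [lieCovec, hσ, dif_pos]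
  exact TensorialAt.mkHom_apply _ hX

/-- `V(T(X,Y)) - T([V,X],Y) - T(X,[V,Y])` at the point `x`. -/
def lieBilinAux (V : VecField I (M := M)) (T : BilinField I (M := M)) (x : M)
    (X Y : VecField I (M := M)) : ℝ :=
  d% (fun y ↦ T y (X y) (Y y)) x (V x) - T x (mlieBracket I V X x) (Y x)
    - T x (X x) (mlieBracket I V Y x)

lemma lieBilinAux_tensorial₁ {V : VecField I (M := M)} {T : BilinField I (M := M)} {x : M}
    (hT : BilinField.DiffAt T x) (Y : VecField I (M := M)) (hY : VecField.DiffAt Y x) :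
    TensorialAt I E (lieBilinAux V T x · Y) x where
  smul {f X} hf hX := by
    have := FiniteDimensional.complete ℝ E
    have h := mvfderiv_fun_mul hf ((hT.apply hX).apply hY)
    simp [lieBilinAux, mlieBracket_smul_right hf hX, h]
    ring
  add {X X'} hX hX' := by
    have := FiniteDimensional.complete ℝ E
    have h := mvfderiv_fun_add ((hT.apply hX).apply hY) ((hT.apply hX').apply hY)
    simp [lieBilinAux, mlieBracket_add_right hX hX', h]
    ring

lemma lieBilinAux_tensorial₂ {V : VecField I (M := M)} {T : BilinField I (M := M)} {x : M}
    (hT : BilinField.DiffAt T x) (X : VecField I (M := M)) (hX : VecField.DiffAt X x) :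
    TensorialAt I E (lieBilinAux V T x X) x where
  smul {f Y} hf hY := by
    have := FiniteDimensional.complete ℝ E
    have h := mvfderiv_fun_mul hf ((hT.apply hX).apply hY)
    simp [lieBilinAux, mlieBracket_smul_right hf hY, h]
    ring
  add {Y Y'} hY hY' := by
    have := FiniteDimensional.complete ℝ E
    have h := mvfderiv_fun_add ((hT.apply hX).apply hY) ((hT.apply hX).apply hY')
    simp [lieBilinAux, mlieBracket_add_right hY hY', h]
    ring

open Classical in
/-- The Lie derivative `£_V T` of a `(0,2)`-tensor field,
`(£_V T)(X,Y) = V(T(X,Y)) - T([V,X],Y) - T(X,[V,Y])`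
(set to `0` at points where `T` is not differentiable). -/
def lieBilin (V : VecField I (M := M)) (T : BilinField I (M := M)) : BilinField I (M := M) :=
  fun x ↦ if hT : BilinField.DiffAt T x then
    TensorialAt.mkHom₂ (lieBilinAux V T x) x (lieBilinAux_tensorial₁ hT)
      (lieBilinAux_tensorial₂ hT) else 0

lemma lieBilin_apply {V : VecField I (M := M)} {T : BilinField I (M := M)} {x : M}
    (hT : BilinField.DiffAt T x) {X Y : VecField I (M := M)}
    (hX : VecField.DiffAt X x) (hY : VecField.DiffAt Y x) :
    lieBilin V T x (X x) (Y x) = d% (fun y ↦ T y (X y) (Y y)) x (V x)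
      - T x (mlieBracket I V X x) (Y x) - T x (X x) (mlieBracket I V Y x) := by
  simp only [lieBilin, hT, dif_pos]
  exact TensorialAt.mkHom₂_apply _ _ hX hY

/-- `X(σ(Y)) - Y(σ(X)) - σ([X,Y])` at the point `x`. -/
def extDerivCovecAux (σ : CovecField I (M := M)) (x : M) (X Y : VecField I (M := M)) : ℝ :=
  d% (fun y ↦ σ y (Y y)) x (X x) - d% (fun y ↦ σ y (X y)) x (Y x) - σ x (mlieBracket I X Y x)

lemma extDerivCovecAux_tensorial₁ {σ : CovecField I (M := M)} {x : M}
    (hσ : CovecField.DiffAt σ x) (Y : VecField I (M := M)) :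
    TensorialAt I E (extDerivCovecAux σ x · Y) x where
  smul {f X} hf hX := by
    have := FiniteDimensional.complete ℝ E
    have h := mvfderiv_fun_mul hf (hσ.apply hX)
    simp [extDerivCovecAux, mlieBracket_smul_left hf hX, h]
    ring
  add {X X'} hX hX' := by
    have := FiniteDimensional.complete ℝ E
    have h := mvfderiv_fun_add (hσ.apply hX) (hσ.apply hX')
    simp [extDerivCovecAux, mlieBracket_add_left hX hX', h]
    ring

lemma extDerivCovecAux_tensorial₂ {σ : CovecField I (M := M)} {x : M}
    (hσ : CovecField.DiffAt σ x) (X : VecField I (M := M)) :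
    TensorialAt I E (extDerivCovecAux σ x X) x where
  smul {f Y} hf hY := by
    have := FiniteDimensional.complete ℝ E
    have h := mvfderiv_fun_mul hf (hσ.apply hY)
    simp [extDerivCovecAux, mlieBracket_smul_right hf hY, h]
    ring
  add {Y Y'} hY hY' := by
    have := FiniteDimensional.complete ℝ E
    have h := mvfderiv_fun_add (hσ.apply hY) (hσ.apply hY')
    simp [extDerivCovecAux, mlieBracket_add_right hY hY', h]
    ring

open Classical in
/-- The exterior derivative of a covector field, `dσ(X,Y) = X(σ(Y)) - Y(σ(X)) - σ([X,Y])`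
(set to `0` at points where `σ` is not differentiable). -/
def extDerivCovec (σ : CovecField I (M := M)) : BilinField I (M := M) :=
  fun x ↦ if hσ : CovecField.DiffAt σ x then
    TensorialAt.mkHom₂ (extDerivCovecAux σ x) x (fun Y _ ↦ extDerivCovecAux_tensorial₁ hσ Y)
      (fun X _ ↦ extDerivCovecAux_tensorial₂ hσ X) else 0

lemma extDerivCovec_apply {σ : CovecField I (M := M)} {x : M}
    (hσ : CovecField.DiffAt σ x) {X Y : VecField I (M := M)}
    (hX : VecField.DiffAt X x) (hY : VecField.DiffAt Y x) :
    extDerivCovec σ x (X x) (Y x) = d% (fun y ↦ σ y (Y y)) x (X x)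
      - d% (fun y ↦ σ y (X y)) x (Y x) - σ x (mlieBracket I X Y x) := by
  simp only [extDerivCovec, hσ, dif_pos]
  exact TensorialAt.mkHom₂_apply _ _ hX hY

/-- `X(σ(Y)) - σ(∇_X Y)` at the point `x`. -/
def covDerivCovecAux (cov : CovariantDerivative I E (TangentSpace I : M → Type _))
    (σ : CovecField I (M := M)) (x : M) (X Y : VecField I (M := M)) : ℝ :=
  d% (fun y ↦ σ y (Y y)) x (X x) - σ x (cov Y x (X x))

lemma covDerivCovecAux_tensorial₁
    {cov : CovariantDerivative I E (TangentSpace I : M → Type _)}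
    {σ : CovecField I (M := M)} {x : M} (Y : VecField I (M := M)) :
    TensorialAt I E (covDerivCovecAux cov σ x · Y) x where
  smul {f X} hf hX := by
    simp [covDerivCovecAux]
    ring
  add {X X'} hX hX' := by
    simp [covDerivCovecAux]
    ring

lemma covDerivCovecAux_tensorial₂
    {cov : CovariantDerivative I E (TangentSpace I : M → Type _)}
    {σ : CovecField I (M := M)} {x : M} (hσ : CovecField.DiffAt σ x) (X : VecField I (M := M)) :
    TensorialAt I E (covDerivCovecAux cov σ x X) x where
  smul {f Y} hf hY := by
    have h := mvfderiv_fun_mul hf (hσ.apply hY)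
    simp [covDerivCovecAux, cov.isCovariantDerivativeOn.leibniz hY hf, h]
    ring
  add {Y Y'} hY hY' := by
    have h := mvfderiv_fun_add (hσ.apply hY) (hσ.apply hY')
    simp [covDerivCovecAux, cov.isCovariantDerivativeOn.add hY hY', h]
    ring

open Classical in
/-- The covariant derivative `∇σ` of a covector field with respect to a connection on the tangent
bundle, `(∇σ)(X,Y) = (∇_X σ)(Y) = X(σ(Y)) - σ(∇_X Y)`; in index notation `∇_a σ_b`, the first slot
being the direction of differentiation
(set to `0` at points where `σ` is not differentiable). -/
def covDerivCovec (cov : CovariantDerivative I E (TangentSpace I : M → Type _))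
    (σ : CovecField I (M := M)) : BilinField I (M := M) :=
  fun x ↦ if hσ : CovecField.DiffAt σ x then
    TensorialAt.mkHom₂ (covDerivCovecAux cov σ x) x (fun Y _ ↦ covDerivCovecAux_tensorial₁ Y)
      (fun X _ ↦ covDerivCovecAux_tensorial₂ hσ X) else 0

lemma covDerivCovec_apply {cov : CovariantDerivative I E (TangentSpace I : M → Type _)}
    {σ : CovecField I (M := M)} {x : M} (hσ : CovecField.DiffAt σ x) {X Y : VecField I (M := M)}
    (hX : VecField.DiffAt X x) (hY : VecField.DiffAt Y x) :
    covDerivCovec cov σ x (X x) (Y x) = d% (fun y ↦ σ y (Y y)) x (X x) - σ x (cov Y x (X x)) := by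
  simp only [covDerivCovec, hσ, dif_pos]
  exact TensorialAt.mkHom₂_apply _ _ hX hY


variable {x : M} {Z Z' : VecField I (M := M)} {f : M → ℝ}

lemma mdiffAt_extend (u : TangentSpace I x) :
    VecField.DiffAt (extend E u : VecField I (M := M)) x := mdifferentiableAt_extend ..

lemma lieCovec_add {σ : CovecField I (M := M)} (hσ : CovecField.DiffAt σ x)
    (hZ : VecField.DiffAt Z x) (hZ' : VecField.DiffAt Z' x) (u : TangentSpace I x) :
    lieCovec (Z + Z') σ x u = lieCovec Z σ x u + lieCovec Z' σ x u := by
  have := FiniteDimensional.complete ℝ E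
  have h (V : VecField I (M := M)) := lieCovec_apply (V := V) hσ (mdiffAt_extend u)
  simp only [extend_apply_self] at h
  rw [h, h, h, mlieBracket_add_left hZ hZ']
  simp
  ring

lemma lieCovec_smul {σ : CovecField I (M := M)} (hσ : CovecField.DiffAt σ x) (hf : MDiffAt f x)
    (hZ : VecField.DiffAt Z x) (u : TangentSpace I x) :
    lieCovec (f • Z) σ x u = f x * lieCovec Z σ x u + d% f x u * σ x (Z x) := by
  have := FiniteDimensional.complete ℝ E
  have h (V : VecField I (M := M)) := lieCovec_apply (V := V) hσ (mdiffAt_extend u)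
  simp only [extend_apply_self] at h
  rw [h, h, mlieBracket_smul_left hf hZ]
  simp
  ring

lemma lieBilin_add {T : BilinField I (M := M)} (hT : BilinField.DiffAt T x)
    (hZ : VecField.DiffAt Z x) (hZ' : VecField.DiffAt Z' x) (u v : TangentSpace I x) :
    lieBilin (Z + Z') T x u v = lieBilin Z T x u v + lieBilin Z' T x u v := by
  have := FiniteDimensional.complete ℝ E
  have h (V : VecField I (M := M)) :=
    lieBilin_apply (V := V) hT (mdiffAt_extend u) (mdiffAt_extend v)
  simp only [extend_apply_self] at h
  rw [h, h, h, mlieBracket_add_left hZ hZ', mlieBracket_add_left hZ hZ']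
  simp
  ring

lemma lieBilin_smul {T : BilinField I (M := M)} (hT : BilinField.DiffAt T x) (hf : MDiffAt f x)
    (hZ : VecField.DiffAt Z x) (u v : TangentSpace I x) :
    lieBilin (f • Z) T x u v = f x * lieBilin Z T x u v + d% f x u * T x (Z x) v
      + d% f x v * T x u (Z x) := by
  have := FiniteDimensional.complete ℝ E
  have h (V : VecField I (M := M)) :=
    lieBilin_apply (V := V) hT (mdiffAt_extend u) (mdiffAt_extend v)
  simp only [extend_apply_self] at h
  rw [h, h, mlieBracket_smul_left hf hZ, mlieBracket_smul_left hf hZ]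
  simp
  ring

lemma extDerivCovec_add {σ σ' : CovecField I (M := M)} (hσ : CovecField.DiffAt σ x)
    (hσ' : CovecField.DiffAt σ' x) (h : CovecField.DiffAt (σ + σ') x) (u v : TangentSpace I x) :
    extDerivCovec (σ + σ') x u v = extDerivCovec σ x u v + extDerivCovec σ' x u v := by
  have hu := mdiffAt_extend u
  have hv := mdiffAt_extend v
  have e1 := mvfderiv_fun_add (hσ.apply hu) (hσ'.apply hu)
  have e2 := mvfderiv_fun_add (hσ.apply hv) (hσ'.apply hv)
  have k1 := extDerivCovec_apply hσ hu hv
  have k2 := extDerivCovec_apply hσ' hu hv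
  have k3 := extDerivCovec_apply h hu hv
  simp only [extend_apply_self, Pi.add_apply, add_apply] at k1 k2 k3
  rw [k1, k2, k3, e1, e2]
  simp
  ring

lemma extDerivCovec_smul {σ : CovecField I (M := M)} (hσ : CovecField.DiffAt σ x)
    (hf : MDiffAt f x) (h : CovecField.DiffAt (fun y ↦ f y • σ y) x) (u v : TangentSpace I x) :
    extDerivCovec (fun y ↦ f y • σ y) x u v =
      f x * extDerivCovec σ x u v + d% f x u * σ x v - d% f x v * σ x u := by
  have hu := mdiffAt_extend u
  have hv := mdiffAt_extend v
  have e1 := mvfderiv_fun_mul hf (hσ.apply hu)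
  have e2 := mvfderiv_fun_mul hf (hσ.apply hv)
  have k1 := extDerivCovec_apply hσ hu hv
  have k3 := extDerivCovec_apply h hu hv
  simp only [extend_apply_self, smul_apply, smul_eq_mul] at k1 k3
  rw [k1, k3, e1, e2]
  simp
  ring

end LieDerivatives

/-! ## Null hypersurface data -/

/-- Null metric hypersurface data `{N, γ, ℓ, ℓ2}` on an `m`-dimensional manifold `N`. -/
structure NullMetricHypersurfaceData (m : ℕ) (N : Type*) [TopologicalSpace N]
    [ChartedSpace (EuclideanSpace ℝ (Fin m)) N] [IsManifold (𝓡 m) ∞ N] where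
  /-- the degenerate metric `γ` -/
  γ : BilinField (𝓡 m) (M := N)
  /-- the covector `ℓ` -/
  ell : CovecField (𝓡 m) (M := N)
  /-- the scalar `ℓ^{(2)}` -/
  ell2 : N → ℝ
  γ_smooth : BilinField.Smooth γ
  ell_smooth : CovecField.Smooth ell
  ell2_smooth : ContMDiff (𝓡 m) 𝓘(ℝ) ∞ ell2
  γ_symm : ∀ x u v, γ x u v = γ x v u
  /-- `γ` has signature `(0,+,…,+)`: it is positive semidefinite with one-dimensional radical -/
  γ_nonneg : ∀ x u, 0 ≤ γ x u u
  γ_radical : ∀ x, finrank ℝ (LinearMap.ker (γ x).toLinearMap) = 1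
  /-- the bilinear form
  `𝓐((W,a),(Z,b)) = γ(W,Z) + a ℓ(Z) + b ℓ(W) + a b ℓ^{(2)}` on `T_xN × ℝ` is non-degenerate -/
  nondegenerate : ∀ x (W : TangentSpace (𝓡 m) x) (a : ℝ),
    (∀ (Z : TangentSpace (𝓡 m) x) (b : ℝ),
      γ x W Z + a * ell x Z + b * ell x W + a * b * ell2 x = 0) → W = 0 ∧ a = 0

/-- Null hypersurface data `{N, γ, ℓ, ℓ2, Y}`: null metric hypersurface data together with a
smooth symmetric `(0,2)`-tensor `Y`. -/
structure NullHypersurfaceData (m : ℕ) (N : Type*) [TopologicalSpace N]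
    [ChartedSpace (EuclideanSpace ℝ (Fin m)) N] [IsManifold (𝓡 m) ∞ N]
    extends NullMetricHypersurfaceData m N where
  /-- the tensor `Y` -/
  Y : BilinField (𝓡 m) (M := N)
  Y_smooth : BilinField.Smooth Y
  Y_symm : ∀ x u v, Y x u v = Y x v u

instance {m : ℕ} {N : Type*} [TopologicalSpace N]
    [ChartedSpace (EuclideanSpace ℝ (Fin m)) N] (x : N) :
    FiniteDimensional ℝ (TangentSpace (𝓡 m) x) :=
  inferInstanceAs (FiniteDimensional ℝ (EuclideanSpace ℝ (Fin m)))

instance {m : ℕ} {N : Type*} [TopologicalSpace N]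
    [ChartedSpace (EuclideanSpace ℝ (Fin m)) N] (x : N) :
    T2Space (TangentSpace (𝓡 m) x) :=
  inferInstanceAs (T2Space (EuclideanSpace ℝ (Fin m)))

lemma finrank_tangentSpace {m : ℕ} {N : Type*} [TopologicalSpace N]
    [ChartedSpace (EuclideanSpace ℝ (Fin m)) N] (x : N) :
    finrank ℝ (TangentSpace (𝓡 m) x) = m :=
  (finrank_euclideanSpace_fin : finrank ℝ (EuclideanSpace ℝ (Fin m)) = m)

namespace NullMetricHypersurfaceData

variable {m : ℕ} {N : Type*} [TopologicalSpace N]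
  [ChartedSpace (EuclideanSpace ℝ (Fin m)) N] [IsManifold (𝓡 m) ∞ N]
  (D : NullMetricHypersurfaceData m N)

/-- The map `T_xN × ℝ → (T_xN)* × ℝ ≃ (T_xN × ℝ)*` induced by the bilinear form `𝓐`, that is
`(W,a) ↦ (γ(W,·) + a ℓ, ℓ(W) + a ℓ^{(2)})`. -/
def ambientMap (x : N) : (TangentSpace (𝓡 m) x × ℝ) →ₗ[ℝ] (Dual ℝ (TangentSpace (𝓡 m) x) × ℝ) where
  toFun p := (((D.γ x p.1 + p.2 • D.ell x : TangentSpace (𝓡 m) x →L[ℝ] ℝ) :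
    TangentSpace (𝓡 m) x →ₗ[ℝ] ℝ), D.ell x p.1 + p.2 * D.ell2 x)
  map_add' p q := by
    ext
    · simp; ring
    · simp; ring
  map_smul' c p := by
    ext
    · simp; ring
    · simp; ring

lemma ambientMap_injective (x : N) : Function.Injective (D.ambientMap x) := by
  rw [injective_iff_map_eq_zero]
  rintro ⟨W, a⟩ h
  have h1 := fun Z ↦ congr($(congr_arg Prod.fst h) Z)
  have h2 := congr_arg Prod.snd h
  simp [ambientMap] at h1 h2
  obtain ⟨hW, ha⟩ := D.nondegenerate x W a fun Z b ↦ by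
    linear_combination h1 Z + b * h2
  simp [hW, ha]

/-- The isomorphism `T_xN × ℝ ≃ (T_xN)* × ℝ` induced by the non-degenerate bilinear form `𝓐`. -/
def ambientEquiv (x : N) :
    (TangentSpace (𝓡 m) x × ℝ) ≃ₗ[ℝ] (Dual ℝ (TangentSpace (𝓡 m) x) × ℝ) :=
  LinearMap.linearEquivOfInjective (D.ambientMap x) (D.ambientMap_injective x) (by
    simp [Subspace.dual_finrank_eq])

/-- The vector field `n` of the splitting
`𝓐⁻¹((α,a),(β,b)) = P(α,β) + a n(β) + b n(α)` of the inverse of `𝓐`. -/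
def n : VecField (𝓡 m) (M := N) := fun x ↦ ((D.ambientEquiv x).symm (0, 1)).1

/-- The symmetric `(2,0)`-tensor `P` of the splitting
`𝓐⁻¹((α,a),(β,b)) = P(α,β) + a n(β) + b n(α)` of the inverse of `𝓐`, as the map `β ↦ P(β,·)`. -/
def P (x : N) : Dual ℝ (TangentSpace (𝓡 m) x) →ₗ[ℝ] TangentSpace (𝓡 m) x where
  toFun β := ((D.ambientEquiv x).symm (β, 0)).1
  map_add' α β := by
    rw [← Prod.fst_add, ← map_add]; simp
  map_smul' c β := by
    rw [RingHom.id_apply, ← Prod.smul_fst, ← map_smul]; simp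


lemma ambientEquiv_n (x : N) : ∃ c : ℝ, D.ambientMap x (D.n x, c) = (0, 1) :=
  ⟨((D.ambientEquiv x).symm (0, 1)).2, (D.ambientEquiv x).apply_symm_apply (0, 1)⟩

lemma ambientEquiv_P (x : N) (β : Dual ℝ (TangentSpace (𝓡 m) x)) :
    ∃ c : ℝ, D.ambientMap x (D.P x β, c) = (β, 0) :=
  ⟨((D.ambientEquiv x).symm (β, 0)).2, (D.ambientEquiv x).apply_symm_apply (β, 0)⟩

lemma γ_n_and_ell_n (x : N) : D.γ x (D.n x) = 0 ∧ D.ell x (D.n x) = 1 := by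
  obtain ⟨c, hc⟩ := D.ambientEquiv_n x
  have h1 := fun Z ↦ congr($(congr_arg Prod.fst hc) Z)
  have h2 := congr_arg Prod.snd hc
  simp [ambientMap] at h1 h2
  obtain ⟨⟨k, hk⟩, hk0, -⟩ := finrank_eq_one_iff'.1 (D.γ_radical x)
  replace hk : D.γ x k = 0 := hk
  have hk0 : k ≠ 0 := fun h ↦ hk0 (by simp [h])
  have hl : D.ell x k ≠ 0 := fun h ↦ hk0 (D.nondegenerate x k 0 (by simp [hk, h])).1
  have hc0 : c = 0 := by
    have := h1 k
    rw [D.γ_symm, hk] at this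
    simpa [hl] using this
  refine ⟨?_, by simpa [hc0] using h2⟩
  ext Z
  simpa [hc0] using h1 Z

/-- `γ_{ab} n^b = 0` -/
lemma γ_n (x : N) : D.γ x (D.n x) = 0 := (D.γ_n_and_ell_n x).1

/-- `ℓ_a n^a = 1` -/
lemma ell_n (x : N) : D.ell x (D.n x) = 1 := (D.γ_n_and_ell_n x).2

lemma γ_P_and_ell_P (x : N) (β : Dual ℝ (TangentSpace (𝓡 m) x)) :
    (∀ Z, D.γ x (D.P x β) Z = β Z - β (D.n x) * D.ell x Z) ∧
      D.ell x (D.P x β) = - D.ell2 x * β (D.n x) := by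
  obtain ⟨c, hc⟩ := D.ambientEquiv_P x β
  have h1 := fun Z ↦ congr($(congr_arg Prod.fst hc) Z)
  have h2 := congr_arg Prod.snd hc
  simp [ambientMap] at h1 h2
  have hc0 : c = β (D.n x) := by
    have := h1 (D.n x)
    rw [D.γ_symm, D.γ_n, D.ell_n] at this
    simpa using this
  refine ⟨fun Z ↦ ?_, ?_⟩
  · rw [← hc0]; linear_combination h1 Z
  · rw [← hc0]; linear_combination h2

/-- `γ_{ca} P^{ab} + ℓ_c n^b = δ_c^b`, with a free covector in the slot `b` -/
lemma γ_P (x : N) (β : Dual ℝ (TangentSpace (𝓡 m) x)) (Z : TangentSpace (𝓡 m) x) :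
    D.γ x (D.P x β) Z = β Z - β (D.n x) * D.ell x Z := (D.γ_P_and_ell_P x β).1 Z

/-- `P^{ab} ℓ_b + ℓ^{(2)} n^a = 0`, with a free covector in the slot `a` -/
lemma ell_P (x : N) (β : Dual ℝ (TangentSpace (𝓡 m) x)) :
    D.ell x (D.P x β) = - D.ell2 x * β (D.n x) := (D.γ_P_and_ell_P x β).2

/-- `P^{ab} γ_{bc} + n^a ℓ_c = δ^a_c` -/
lemma P_γ (x : N) (u : TangentSpace (𝓡 m) x) :
    D.P x (D.γ x u).toLinearMap = u - D.ell x u • D.n x := by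
  have h : (D.ambientEquiv x).symm ((D.γ x u).toLinearMap, 0) = (u - D.ell x u • D.n x, 0) := by
    rw [LinearEquiv.symm_apply_eq]
    change _ = D.ambientMap x _
    simp [ambientMap, D.γ_n, D.ell_n]
  change ((D.ambientEquiv x).symm ((D.γ x u).toLinearMap, 0)).1 = _
  rw [h]

/-- `F = ½ dℓ` -/
def F : BilinField (𝓡 m) (M := N) := fun x ↦ (1 / 2 : ℝ) • extDerivCovec D.ell x

/-- `s = F(n,·)` -/
def s : CovecField (𝓡 m) (M := N) := fun x ↦ D.F x (D.n x)

/-- `U = ½ £_n γ` -/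
def U : BilinField (𝓡 m) (M := N) := fun x ↦ (1 / 2 : ℝ) • lieBilin D.n D.γ x

/-- A torsion-free connection on `TN` that satisfies the two equations
`∇_a γ_{bc} = - ℓ_b U_{ac} - ℓ_c U_{ab}` and `∇_a ℓ_b = F_{ab} - ℓ^{(2)} U_{ab}`. -/
structure IsMetricHypersurfaceConnection
    (cov : CovariantDerivative (𝓡 m) (EuclideanSpace ℝ (Fin m))
      (TangentSpace (𝓡 m) : N → Type _)) : Prop where
  torsion_free : cov.torsion = 0
  nabla_γ : ∀ (x : N) (X Y Z : VecField (𝓡 m) (M := N)), VecField.DiffAt X x → VecField.DiffAt Y x →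
    VecField.DiffAt Z x →
    mvfderiv (𝓡 m) (fun y ↦ D.γ y (Y y) (Z y)) x (X x) - D.γ x (cov Y x (X x)) (Z x)
      - D.γ x (Y x) (cov Z x (X x))
      = - D.ell x (Y x) * D.U x (X x) (Z x) - D.ell x (Z x) * D.U x (X x) (Y x)
  nabla_ell : ∀ (x : N) (u v : TangentSpace (𝓡 m) x),
    covDerivCovec cov D.ell x u v = D.F x u v - D.ell2 x * D.U x u v

lemma γ_diffAt (x : N) : BilinField.DiffAt D.γ x := (D.γ_smooth x).mdifferentiableAt (by simp)

lemma ell_diffAt (x : N) : CovecField.DiffAt D.ell x :=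
  (D.ell_smooth x).mdifferentiableAt (by simp)

/-- The operator `Z ↦ ∇Z` of the metric hypersurface connection, given by the Koszul-type formula
`∇_X Z = ½ P((£_Z γ + d(γ(Z,·)))(X,·)) + ½ ((£_Z ℓ)(X) + X(ℓ(Z))) n`
(the connection `metricConnection` below is this operator, and
`metricConnection_isMetricHypersurfaceConnection` and `IsMetricHypersurfaceConnection.eq` show that
it is the one and only metric hypersurface connection). -/
def metricConnectionAux (Z : VecField (𝓡 m) (M := N)) (x : N) :
    TangentSpace (𝓡 m) x →L[ℝ] TangentSpace (𝓡 m) x :=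
  LinearMap.toContinuousLinearMap
    ((1 / 2 : ℝ) • (D.P x ∘ₗ ContinuousLinearMap.coeLM ℝ ∘ₗ
        (lieBilin Z D.γ x + extDerivCovec (fun y ↦ D.γ y (Z y)) x).toLinearMap)
      + (1 / 2 : ℝ) • (lieCovec Z D.ell x +
        mvfderiv (𝓡 m) (fun y ↦ D.ell y (Z y)) x).toLinearMap.smulRight (D.n x))


lemma metricConnectionAux_apply (Z : VecField (𝓡 m) (M := N)) (x : N)
    (u : TangentSpace (𝓡 m) x) :
    D.metricConnectionAux Z x u =
      (1 / 2 : ℝ) • D.P x (lieBilin Z D.γ x u + extDerivCovec (fun y ↦ D.γ y (Z y)) x u).toLinearMap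
      + (1 / 2 : ℝ) • (lieCovec Z D.ell x u +
        mvfderiv (𝓡 m) (fun y ↦ D.ell y (Z y)) x u) • D.n x := by
  simp [metricConnectionAux]

lemma metricConnectionAux_isCovariantDerivativeOn :
    IsCovariantDerivativeOn (EuclideanSpace ℝ (Fin m)) D.metricConnectionAux where
  add {Z Z' x} hZ hZ' _ := by
    have hZZ' : VecField.DiffAt (Z + Z') x := mdifferentiableAt_add_section hZ hZ'
    have hγ := D.γ_diffAt x
    have hl := D.ell_diffAt x
    have e1 : (fun y ↦ D.γ y ((Z + Z') y)) = (fun y ↦ D.γ y (Z y)) + (fun y ↦ D.γ y (Z' y)) := by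
      ext; simp
    ext1 u
    have e2 : lieBilin (Z + Z') D.γ x u + extDerivCovec (fun y ↦ D.γ y ((Z + Z') y)) x u =
        (lieBilin Z D.γ x u + extDerivCovec (fun y ↦ D.γ y (Z y)) x u) +
        (lieBilin Z' D.γ x u + extDerivCovec (fun y ↦ D.γ y (Z' y)) x u) := by
      ext v
      have := extDerivCovec_add (hγ.apply hZ) (hγ.apply hZ') (by
        have := hγ.apply hZZ'; rwa [e1] at this) u v
      simp only [add_apply, lieBilin_add hγ hZ hZ', e1, this]
      ring
    have e3 := mvfderiv_fun_add (hl.apply hZ) (hl.apply hZ')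
    have e4 : (fun y ↦ D.ell y ((Z + Z') y)) = fun y ↦ D.ell y (Z y) + D.ell y (Z' y) := by
      ext; simp
    rw [add_apply, metricConnectionAux_apply, e2, e4, e3,
      lieCovec_add hl hZ hZ', metricConnectionAux_apply, metricConnectionAux_apply]
    simp only [ContinuousLinearMap.toLinearMap_add, map_add, add_apply]
    module
  leibniz {Z f x} hZ hf _ := by
    have hfZ : VecField.DiffAt (f • Z) x := hf.smul_section hZ
    have hγ := D.γ_diffAt x
    have hl := D.ell_diffAt x
    have e1 : (fun y ↦ D.γ y ((f • Z) y)) = fun y ↦ f y • D.γ y (Z y) := by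
      ext; simp
    ext1 u
    have e2 : lieBilin (f • Z) D.γ x u + extDerivCovec (fun y ↦ D.γ y ((f • Z) y)) x u =
        f x • (lieBilin Z D.γ x u + extDerivCovec (fun y ↦ D.γ y (Z y)) x u) +
        (2 * mvfderiv (𝓡 m) f x u) • D.γ x (Z x) := by
      ext v
      have := extDerivCovec_smul (hγ.apply hZ) hf (by
        have := hγ.apply hfZ; rwa [e1] at this) u v
      simp only [add_apply, lieBilin_smul hγ hf hZ, e1, this,
        smul_apply, smul_eq_mul, D.γ_symm x u (Z x)]
      ring
    have e3 := mvfderiv_fun_mul hf (hl.apply hZ)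
    have e4 : (fun y ↦ D.ell y ((f • Z) y)) = fun y ↦ f y * D.ell y (Z y) := by
      ext; simp
    rw [metricConnectionAux_apply, e2, e4, e3, lieCovec_smul hl hf hZ]
    simp only [ContinuousLinearMap.toLinearMap_add, map_add, add_apply,
      ContinuousLinearMap.toLinearMap_smul, map_smul, P_γ, smul_apply,
      metricConnectionAux_apply, ContinuousLinearMap.smulRight_apply, smul_eq_mul]
    module

/-- The metric hypersurface connection of null metric hypersurface data. -/
def metricConnection : CovariantDerivative (𝓡 m) (EuclideanSpace ℝ (Fin m))
    (TangentSpace (𝓡 m) : N → Type _) where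
  toFun := D.metricConnectionAux
  isCovariantDerivativeOnUniv := D.metricConnectionAux_isCovariantDerivativeOn


lemma n_smooth : VecField.Smooth D.n := by
  intro x₀
  let t := trivializationAt (EuclideanSpace ℝ (Fin m)) (TangentSpace (𝓡 m) : N → Type _) x₀
  let T := trivializationAt (EuclideanSpace ℝ (Fin m) →L[ℝ] ℝ)
    (fun y : N ↦ TangentSpace (𝓡 m) y →L[ℝ] ℝ) x₀
  let lam : N → (EuclideanSpace ℝ (Fin m) →L[ℝ] ℝ) := fun y ↦ (T ⟨y, D.ell y⟩).2
  let G : N → (EuclideanSpace ℝ (Fin m) →L[ℝ] EuclideanSpace ℝ (Fin m) →L[ℝ] ℝ) :=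
    fun y ↦ ContinuousLinearMap.inCoordinates (EuclideanSpace ℝ (Fin m))
      (TangentSpace (𝓡 m) : N → Type _) (EuclideanSpace ℝ (Fin m) →L[ℝ] ℝ)
      (fun y : N ↦ TangentSpace (𝓡 m) y →L[ℝ] ℝ) x₀ y x₀ y (D.γ y)
  have hlam : ContMDiffAt (𝓡 m) 𝓘(ℝ, EuclideanSpace ℝ (Fin m) →L[ℝ] ℝ) ∞ lam x₀ :=
    (contMDiffAt_section x₀).1 (D.ell_smooth x₀)
  have hG : ContMDiffAt (𝓡 m)
      𝓘(ℝ, EuclideanSpace ℝ (Fin m) →L[ℝ] EuclideanSpace ℝ (Fin m) →L[ℝ] ℝ) ∞ G x₀ :=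
    ((contMDiffAt_hom_bundle _).1 (D.γ_smooth x₀)).2
  let B : N → (EuclideanSpace ℝ (Fin m) →L[ℝ] EuclideanSpace ℝ (Fin m) →L[ℝ] ℝ) :=
    fun y ↦ G y + (lam y).smulRight (lam y)
  have hB : ContMDiffAt (𝓡 m)
      𝓘(ℝ, EuclideanSpace ℝ (Fin m) →L[ℝ] EuclideanSpace ℝ (Fin m) →L[ℝ] ℝ) ∞ B x₀ := by
    have h1 : ContDiff ℝ ∞ fun l : EuclideanSpace ℝ (Fin m) →L[ℝ] ℝ ↦ l.smulRight l :=
      contDiff_id.smulRight contDiff_id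
    exact hG.add (h1.contMDiff.contMDiffAt.comp x₀ hlam)
  have hlaT (y : N) (hy : y ∈ t.baseSet) (σ : TangentSpace (𝓡 m) y →L[ℝ] ℝ)
      (a : EuclideanSpace ℝ (Fin m)) : (T ⟨y, σ⟩).2 a = σ (t.symm y a) := by
    simp only [T, hom_trivializationAt_apply]
    rw [ContinuousLinearMap.inCoordinates_eq hy (by simp)]
    simp [t]
  have hGa (y : N) (hy : y ∈ t.baseSet) (a b : EuclideanSpace ℝ (Fin m)) :
      G y a b = D.γ y (t.symm y a) (t.symm y b) := by
    have hy' : y ∈ T.baseSet := by simpa [T, t] using hy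
    have : G y a = (T ⟨y, D.γ y (t.symm y a)⟩).2 := by
      simp only [G]
      rw [ContinuousLinearMap.inCoordinates_eq hy hy']
      simp [t, T]
    rw [this, hlaT y hy]
  have hBa (y : N) (hy : y ∈ t.baseSet) (a b : EuclideanSpace ℝ (Fin m)) :
      B y a b = D.γ y (t.symm y a) (t.symm y b)
        + D.ell y (t.symm y a) * D.ell y (t.symm y b) := by
    simp [B, hGa y hy, lam, hlaT y hy]
  have hn (y : N) (hy : y ∈ t.baseSet) : t.symm y (t ⟨y, D.n y⟩).2 = D.n y :=
    t.symm_apply_apply_mk hy (D.n y)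
  have hBn (y : N) (hy : y ∈ t.baseSet) : B y (t ⟨y, D.n y⟩).2 = lam y := by
    ext a
    rw [hBa y hy, hn y hy, D.γ_n, D.ell_n, hlaT y hy]
    simp
  have hinj (y : N) (hy : y ∈ t.baseSet) : Function.Injective (B y) := by
    rw [injective_iff_map_eq_zero]
    intro a ha
    have h1 : D.ell y (t.symm y a) = 0 := by
      have := hBa y hy a (t ⟨y, D.n y⟩).2
      rw [ha, hn y hy, D.γ_symm, D.γ_n, D.ell_n] at this
      simpa using this.symm
    have h2 (Z) : D.γ y (t.symm y a) Z = 0 := by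
      have := hBa y hy a (t ⟨y, Z⟩).2
      rw [ha, h1, t.symm_apply_apply_mk hy] at this
      simpa using this.symm
    have h3 : t.symm y a = 0 := (D.nondegenerate y _ 0 (by simp [h1, h2])).1
    have h4 := t.apply_mk_symm hy a
    rw [h3] at h4
    have h5 := congr_arg Prod.snd h4
    simp only at h5
    rw [← h5]
    exact (t.linear ℝ hy).map_zero
  have hfin : finrank ℝ (EuclideanSpace ℝ (Fin m)) =
      finrank ℝ (EuclideanSpace ℝ (Fin m) →L[ℝ] ℝ) := by
    rw [← (LinearMap.toContinuousLinearMap : (EuclideanSpace ℝ (Fin m) →ₗ[ℝ] ℝ) ≃ₗ[ℝ] _).finrank_eq]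
    exact Subspace.dual_finrank_eq.symm
  have hequiv (y : N) (hy : y ∈ t.baseSet) :
      ∃ e : EuclideanSpace ℝ (Fin m) ≃L[ℝ] (EuclideanSpace ℝ (Fin m) →L[ℝ] ℝ), e = B y :=
    ⟨(LinearMap.linearEquivOfInjective (B y).toLinearMap (hinj y hy) hfin).toContinuousLinearEquiv,
      by ext; rfl⟩
  have hx₀ : x₀ ∈ t.baseSet := mem_baseSet_trivializationAt' x₀
  have hmem : t.baseSet ∈ 𝓝 x₀ := t.open_baseSet.mem_nhds hx₀
  obtain ⟨e, he⟩ := hequiv x₀ hx₀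
  have hinv : ContDiffAt ℝ ∞ ContinuousLinearMap.inverse (B x₀) := he ▸ contDiffAt_map_inverse e
  have hfinal := (hinv.contMDiffAt.comp x₀ hB).clm_apply hlam
  refine (contMDiffAt_section x₀).2 (hfinal.congr_of_eventuallyEq ?_)
  filter_upwards [hmem] with y hy
  obtain ⟨e, he⟩ := hequiv y hy
  simp only [Function.comp_apply]
  rw [← he, ContinuousLinearMap.inverse_equiv, ← hBn y hy, ← he]
  simp [t]


section Characterization

variable {x : N} {X Y Z : VecField (𝓡 m) (M := N)}

lemma koszul_apply (hX : VecField.DiffAt X x) (hY : VecField.DiffAt Y x)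
    (hZ : VecField.DiffAt Z x) :
    (lieBilin Y D.γ x (X x) + extDerivCovec (fun y ↦ D.γ y (Y y)) x (X x)) (Z x) =
      mvfderiv (𝓡 m) (fun y ↦ D.γ y (X y) (Z y)) x (Y x)
      + mvfderiv (𝓡 m) (fun y ↦ D.γ y (Y y) (Z y)) x (X x)
      - mvfderiv (𝓡 m) (fun y ↦ D.γ y (X y) (Y y)) x (Z x)
      + D.γ x (mlieBracket (𝓡 m) X Y x) (Z x) - D.γ x (X x) (mlieBracket (𝓡 m) Y Z x)
      - D.γ x (Y x) (mlieBracket (𝓡 m) X Z x) := by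
  have hγ := D.γ_diffAt x
  rw [add_apply, lieBilin_apply hγ hX hZ,
    extDerivCovec_apply (hγ.apply hY) hX hZ, mlieBracket_swap_apply (V := Y) (W := X)]
  have : (fun y ↦ D.γ y (Y y) (X y)) = fun y ↦ D.γ y (X y) (Y y) := by
    ext y; rw [D.γ_symm]
  rw [this]
  simp
  ring

lemma γ_metricConnection (hX : VecField.DiffAt X x) (hY : VecField.DiffAt Y x)
    (_hZ : VecField.DiffAt Z x) :
    2 * D.γ x (D.metricConnection Y x (X x)) (Z x) =
      (lieBilin Y D.γ x (X x) + extDerivCovec (fun y ↦ D.γ y (Y y)) x (X x)) (Z x)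
      + 2 * D.ell x (Z x) * D.U x (X x) (Y x) := by
  have hn : VecField.DiffAt D.n x := (D.n_smooth x).mdifferentiableAt (by simp)
  have h1 := D.koszul_apply hX hY hn
  have h2 (W : VecField (𝓡 m) (M := N)) : (fun y ↦ D.γ y (W y) (D.n y)) = fun _ ↦ (0 : ℝ) := by
    ext y; rw [D.γ_symm, D.γ_n]; rfl
  rw [h2, h2, D.γ_symm x _ (D.n x), D.γ_n, mvfderiv_const] at h1
  change 2 * D.γ x (D.metricConnectionAux Y x (X x)) (Z x) = _
  rw [metricConnectionAux_apply]
  simp only [map_add, map_smul, add_apply, smul_apply,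
    γ_P, γ_n, U, lieBilin_apply (D.γ_diffAt x) hX hY, ContinuousLinearMap.coe_coe]
  simp only [add_apply] at h1
  rw [h1, mlieBracket_swap_apply (V := D.n) (W := X), mlieBracket_swap_apply (V := D.n) (W := Y),
    D.γ_symm x (Y x)]
  simp
  ring

lemma ell_metricConnection (hX : VecField.DiffAt X x) (hY : VecField.DiffAt Y x) :
    2 * D.ell x (D.metricConnection Y x (X x)) =
      mvfderiv (𝓡 m) (fun y ↦ D.ell y (X y)) x (Y x)
      + mvfderiv (𝓡 m) (fun y ↦ D.ell y (Y y)) x (X x)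
      + D.ell x (mlieBracket (𝓡 m) X Y x) + 2 * D.ell2 x * D.U x (X x) (Y x) := by
  have hn : VecField.DiffAt D.n x := (D.n_smooth x).mdifferentiableAt (by simp)
  have h1 := D.koszul_apply hX hY hn
  have h2 (W : VecField (𝓡 m) (M := N)) : (fun y ↦ D.γ y (W y) (D.n y)) = fun _ ↦ (0 : ℝ) := by
    ext y; rw [D.γ_symm, D.γ_n]; rfl
  rw [h2, h2, D.γ_symm x _ (D.n x), D.γ_n, mvfderiv_const] at h1
  change 2 * D.ell x (D.metricConnectionAux Y x (X x)) = _
  rw [metricConnectionAux_apply]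
  simp only [map_add, map_smul, ell_P, ell_n, U, lieBilin_apply (D.γ_diffAt x) hX hY,
    lieCovec_apply (D.ell_diffAt x) hX, smul_apply,
    ContinuousLinearMap.coe_coe]
  rw [h1, mlieBracket_swap_apply (V := D.n) (W := X), mlieBracket_swap_apply (V := D.n) (W := Y),
    D.γ_symm x (Y x), mlieBracket_swap_apply (V := Y) (W := X)]
  simp
  ring

/-- The metric connection satisfies the defining equations of the metric hypersurface connection. -/
theorem metricConnection_isMetricHypersurfaceConnection :
    D.IsMetricHypersurfaceConnection D.metricConnection where
  torsion_free := by
    rw [CovariantDerivative.torsion_eq_zero_iff]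
    intro X Y x hX hY
    rw [← sub_eq_zero]
    have hU : D.U x (X x) (Y x) = D.U x (Y x) (X x) := by
      simp only [U, smul_apply, lieBilin_apply (D.γ_diffAt x) hX hY,
        lieBilin_apply (D.γ_diffAt x) hY hX, D.γ_symm _ (X _), D.γ_symm x (mlieBracket _ _ X x)]
      ring_nf
    refine (D.nondegenerate x _ 0 fun Z b ↦ ?_).1
    have hZ := mdiffAt_extend (I := 𝓡 m) Z
    have h1 := D.γ_metricConnection hX hY hZ
    have h2 := D.γ_metricConnection hY hX hZ
    have h3 := D.ell_metricConnection hX hY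
    have h4 := D.ell_metricConnection hY hX
    rw [D.koszul_apply hX hY hZ] at h1
    rw [D.koszul_apply hY hX hZ] at h2
    have h5 : (fun y ↦ D.γ y (Y y) (X y)) = fun y ↦ D.γ y (X y) (Y y) := by
      ext y; rw [D.γ_symm]
    rw [mlieBracket_swap_apply (V := Y) (W := X)] at h2 h4
    rw [h5] at h2
    simp only [extend_apply_self, map_neg, neg_apply] at h1 h2 h3 h4
    simp only [map_sub, sub_apply]
    linear_combination (h1 - h2) / 2 + b * (h3 - h4) / 2 +
      (D.ell x Z + b * D.ell2 x) * hU
  nabla_γ x X Y Z hX hY hZ := by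
    have h1 := D.γ_metricConnection hX hY hZ
    have h2 := D.γ_metricConnection hX hZ hY
    rw [D.koszul_apply hX hY hZ] at h1
    rw [D.koszul_apply hX hZ hY] at h2
    have h5 : (fun y ↦ D.γ y (Z y) (Y y)) = fun y ↦ D.γ y (Y y) (Z y) := by
      ext y; rw [D.γ_symm]
    rw [mlieBracket_swap_apply (V := Z) (W := Y), D.γ_symm x (mlieBracket _ _ _ _),
      h5] at h2
    rw [D.γ_symm x (mlieBracket _ _ _ _)] at h1
    simp only [map_neg] at h1 h2
    rw [D.γ_symm x (Y x) (D.metricConnection Z x (X x))]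
    linear_combination -(h1 + h2) / 2
  nabla_ell x u v := by
    have hu := mdiffAt_extend (I := 𝓡 m) u
    have hv := mdiffAt_extend (I := 𝓡 m) v
    have h1 := covDerivCovec_apply (cov := D.metricConnection) (D.ell_diffAt x) hu hv
    have h2 := D.ell_metricConnection hu hv
    have h3 := extDerivCovec_apply (D.ell_diffAt x) hu hv
    simp only [extend_apply_self] at h1 h2 h3
    rw [h1]
    simp only [F, smul_apply, h3, smul_eq_mul]
    linear_combination - h2 / 2

/-- There is only one metric hypersurface connection. -/
theorem IsMetricHypersurfaceConnection.eq
    {cov cov' : CovariantDerivative (𝓡 m) (EuclideanSpace ℝ (Fin m))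
      (TangentSpace (𝓡 m) : N → Type _)}
    (h : D.IsMetricHypersurfaceConnection cov) (h' : D.IsMetricHypersurfaceConnection cov')
    (hX : VecField.DiffAt X x) : cov X x = cov' X x := by
  let S (u v : TangentSpace (𝓡 m) x) : TangentSpace (𝓡 m) x :=
    cov (extend (EuclideanSpace ℝ (Fin m)) v) x u - cov' (extend (EuclideanSpace ℝ (Fin m)) v) x u
  have hsymm (u v) : S u v = S v u := by
    have hu := mdiffAt_extend (I := 𝓡 m) u
    have hv := mdiffAt_extend (I := 𝓡 m) v
    have h1 := cov.torsion_eq_zero_iff.1 h.torsion_free hu hv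
    have h2 := cov'.torsion_eq_zero_iff.1 h'.torsion_free hu hv
    simp only [extend_apply_self] at h1 h2
    rw [← h2, sub_eq_sub_iff_add_eq_add] at h1
    simp only [S]
    rw [sub_eq_sub_iff_add_eq_add]
    rw [h1, add_comm]
  have hskew (u v w) : D.γ x (S u v) w + D.γ x v (S u w) = 0 := by
    have hu := mdiffAt_extend (I := 𝓡 m) u
    have hv := mdiffAt_extend (I := 𝓡 m) v
    have hw := mdiffAt_extend (I := 𝓡 m) w
    have h1 := h.nabla_γ x _ _ _ hu hv hw
    have h2 := h'.nabla_γ x _ _ _ hu hv hw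
    simp only [extend_apply_self] at h1 h2
    simp only [S, map_sub, sub_apply]
    linear_combination h2 - h1
  have hell (u v) : D.ell x (S u v) = 0 := by
    have hu := mdiffAt_extend (I := 𝓡 m) u
    have hv := mdiffAt_extend (I := 𝓡 m) v
    have h1 := covDerivCovec_apply (cov := cov) (D.ell_diffAt x) hu hv
    have h2 := covDerivCovec_apply (cov := cov') (D.ell_diffAt x) hu hv
    rw [h.nabla_ell] at h1
    rw [h'.nabla_ell, h1] at h2
    simp only [extend_apply_self] at h2
    simp only [S, map_sub]
    linear_combination -h2
  have hγS (u v w) : D.γ x (S u v) w = 0 := by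
    have a1 := hskew u v w
    have a2 := hskew v w u
    have a3 := hskew w u v
    rw [D.γ_symm x v] at a1
    rw [D.γ_symm x w, hsymm v u] at a2
    rw [D.γ_symm x u, hsymm w u, hsymm w v] at a3
    linear_combination (a1 + a2 - a3) / 2
  have hS (u v) : S u v = 0 := (D.nondegenerate x _ 0 (by simp [hγS, hell])).1
  ext1 u
  have h1 := congr($(cov.isCovariantDerivativeOn.difference_apply
    cov'.isCovariantDerivativeOn (Set.mem_univ x) hX) u)
  have h2 := congr($(cov.isCovariantDerivativeOn.difference_apply
    cov'.isCovariantDerivativeOn (Set.mem_univ x) (mdiffAt_extend (I := 𝓡 m) (X x))) u)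
  simp only [extend_apply_self] at h2
  rw [h1] at h2
  have h3 := hS u (X x)
  simp only [S] at h3
  rw [← sub_eq_zero, ← h3]
  simpa using h2

end Characterization

end NullMetricHypersurfaceData

/-! ## Spacetimes and embedded data -/

/-- A smooth Lorentzian metric of signature `(-,+,…,+)` on a manifold of dimension `m + 1`. -/
structure LorentzianMetric (m : ℕ) (M : Type*) [TopologicalSpace M]
    [ChartedSpace (EuclideanSpace ℝ (Fin (m + 1))) M] [IsManifold (𝓡 (m + 1)) ∞ M] where
  /-- the metric tensor -/
  g : BilinField (𝓡 (m + 1)) (M := M)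
  g_smooth : BilinField.Smooth g
  g_symm : ∀ y u v, g y u v = g y v u
  /-- at every point there is an orthonormal basis with exactly one timelike vector -/
  g_signature : ∀ y, ∃ b : Basis (Fin (m + 1)) ℝ (TangentSpace (𝓡 (m + 1)) y),
    ∀ i j, g y (b i) (b j) = if i = j then (if i = 0 then -1 else 1) else 0

namespace LorentzianMetric

variable {m : ℕ} {M : Type*} [TopologicalSpace M]
  [ChartedSpace (EuclideanSpace ℝ (Fin (m + 1))) M] [IsManifold (𝓡 (m + 1)) ∞ M]
  (S : LorentzianMetric m M)

/-- The map `u ↦ g(u,·)`. -/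
def flatMap (y : M) : TangentSpace (𝓡 (m + 1)) y →ₗ[ℝ] Dual ℝ (TangentSpace (𝓡 (m + 1)) y) :=
  ContinuousLinearMap.coeLM ℝ ∘ₗ (S.g y).toLinearMap

lemma flatMap_apply (y : M) (u v : TangentSpace (𝓡 (m + 1)) y) : S.flatMap y u v = S.g y u v := rfl

lemma flatMap_injective (y : M) : Function.Injective (S.flatMap y) := by
  rw [injective_iff_map_eq_zero]
  intro u hu
  obtain ⟨b, hb⟩ := S.g_signature y
  refine b.ext_elem fun j ↦ ?_
  have h : S.g y u (b j) = 0 := by rw [← flatMap_apply, hu]; rfl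
  rw [← b.sum_repr u] at h
  simp only [map_sum, map_smul, sum_apply, smul_apply, hb, smul_eq_mul,
    mul_ite, mul_zero, Finset.sum_ite_eq', Finset.mem_univ, if_true] at h
  by_cases hj : j = 0 <;> simpa [hj] using h

/-- The inverse metric `g^♯`, as the isomorphism `σ ↦ g^♯(σ,·)` from covectors to vectors. -/
def sharp (y : M) : Dual ℝ (TangentSpace (𝓡 (m + 1)) y) ≃ₗ[ℝ] TangentSpace (𝓡 (m + 1)) y :=
  (LinearMap.linearEquivOfInjective (S.flatMap y) (S.flatMap_injective y)
    Subspace.dual_finrank_eq.symm).symm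

lemma g_sharp (y : M) (σ : Dual ℝ (TangentSpace (𝓡 (m + 1)) y))
    (v : TangentSpace (𝓡 (m + 1)) y) : S.g y (S.sharp y σ) v = σ v := by
  have h : S.flatMap y (S.sharp y σ) = σ := (S.sharp y).symm_apply_apply σ
  rw [← flatMap_apply, h]

/-- The deformation tensor `£_η g` of a vector field `η`. -/
def deformation (η : VecField (𝓡 (m + 1)) (M := M)) : BilinField (𝓡 (m + 1)) (M := M) :=
  lieBilin η S.g

end LorentzianMetric

variable {m : ℕ} {N : Type*} [TopologicalSpace N] [ChartedSpace (EuclideanSpace ℝ (Fin m)) N]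
  [IsManifold (𝓡 m) ∞ N] {M : Type*} [TopologicalSpace M]
  [ChartedSpace (EuclideanSpace ℝ (Fin (m + 1))) M] [IsManifold (𝓡 (m + 1)) ∞ M]

/-- The null hypersurface data `D` is `{φ,ζ}`-embedded in the spacetime `(M,g)`. The rigging along
`φ(N)` is the restriction to `φ(N)` of the vector field `ζ`, which is defined and smooth on the
open neighbourhood `O` of `φ(N)`. -/
structure IsEmbeddedData (D : NullHypersurfaceData m N) (S : LorentzianMetric m M) (φ : N → M)
    (O : Set M) (ζ : VecField (𝓡 (m + 1)) (M := M)) : Prop where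
  embedding : Manifold.IsSmoothEmbedding (𝓡 m) (𝓡 (m + 1)) ∞ φ
  isOpen : IsOpen O
  range_subset : Set.range φ ⊆ O
  rigging_smooth : VecField.SmoothOn ζ O
  transverse : ∀ x, ζ (φ x) ∉ Set.range (mfderiv (𝓡 m) (𝓡 (m + 1)) φ x)
  /-- `φ^* g = γ` -/
  pullback_g : ∀ x (u v : TangentSpace (𝓡 m) x), S.g (φ x) (mfderiv (𝓡 m) (𝓡 (m + 1)) φ x u)
    (mfderiv (𝓡 m) (𝓡 (m + 1)) φ x v) = D.γ x u v
  /-- `φ^*(g(ζ,·)) = ℓ` -/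
  pullback_g_rigging : ∀ x (u : TangentSpace (𝓡 m) x),
    S.g (φ x) (ζ (φ x)) (mfderiv (𝓡 m) (𝓡 (m + 1)) φ x u) = D.ell x u
  /-- `φ^*(g(ζ,ζ)) = ℓ^{(2)}` -/
  pullback_g_rigging_rigging : ∀ x, S.g (φ x) (ζ (φ x)) (ζ (φ x)) = D.ell2 x
  /-- `½ φ^*(£_ζ g) = Y` -/
  pullback_lie : ∀ x (u v : TangentSpace (𝓡 m) x),
    (1 / 2 : ℝ) * lieBilin ζ S.g (φ x) (mfderiv (𝓡 m) (𝓡 (m + 1)) φ x u)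
      (mfderiv (𝓡 m) (𝓡 (m + 1)) φ x v) = D.Y x u v

namespace IsEmbeddedData

variable {D : NullHypersurfaceData m N} {S : LorentzianMetric m M} {φ : N → M} {O : Set M}
  {ζ : VecField (𝓡 (m + 1)) (M := M)}

lemma frameMap_injective (h : IsEmbeddedData D S φ O ζ) (x : N) : Function.Injective
    ((mfderiv (𝓡 m) (𝓡 (m + 1)) φ x).toLinearMap.coprod
      (LinearMap.toSpanSingleton ℝ (TangentSpace (𝓡 (m + 1)) (φ x)) (ζ (φ x)))) := by
  rw [injective_iff_map_eq_zero]
  rintro ⟨W, a⟩ h0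
  replace h0 : mfderiv (𝓡 m) (𝓡 (m + 1)) φ x W + a • ζ (φ x) = 0 := by simpa using h0
  obtain ⟨hW, ha⟩ := D.nondegenerate x W a fun Z b ↦ by
    have h1 : S.g (φ x) (mfderiv (𝓡 m) (𝓡 (m + 1)) φ x W + a • ζ (φ x))
      (mfderiv (𝓡 m) (𝓡 (m + 1)) φ x Z + b • ζ (φ x)) = 0 := by rw [h0]; simp
    simp only [map_add, map_smul, add_apply, smul_apply, h.pullback_g, h.pullback_g_rigging,
      h.pullback_g_rigging_rigging, S.g_symm _ (mfderiv (𝓡 m) (𝓡 (m + 1)) φ x W) (ζ (φ x)),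
      smul_eq_mul] at h1
    linear_combination h1
  simp [hW, ha]

/-- The isomorphism `T_xN × ℝ ≃ T_{φ(x)}M`, `(u,a) ↦ φ_* u + a ζ`. Its inverse sends a vector to
its components with respect to `{e_a, ζ}`. -/
def frameEquiv (h : IsEmbeddedData D S φ O ζ) (x : N) :
    (TangentSpace (𝓡 m) x × ℝ) ≃ₗ[ℝ] TangentSpace (𝓡 (m + 1)) (φ x) :=
  LinearMap.linearEquivOfInjective _ (h.frameMap_injective x) (by
    simp [finrank_tangentSpace])

lemma frameEquiv_apply (h : IsEmbeddedData D S φ O ζ) (x : N) (u : TangentSpace (𝓡 m) x) (a : ℝ) :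
    h.frameEquiv x (u, a) = mfderiv (𝓡 m) (𝓡 (m + 1)) φ x u + a • ζ (φ x) := by
  simp [frameEquiv]

/-- For a basis `{ê_a}` of `T_xN`, the basis `{ζ, e_a = φ_* ê_a}` of `T_{φ(x)}M`; the index `none`
stands for `ζ`. -/
def frame (h : IsEmbeddedData D S φ O ζ) (x : N) (e : Basis (Fin m) ℝ (TangentSpace (𝓡 m) x)) :
    Basis (Option (Fin m)) ℝ (TangentSpace (𝓡 (m + 1)) (φ x)) :=
  ((e.prod (Basis.singleton Unit ℝ)).map (h.frameEquiv x)).reindex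
    (Equiv.optionEquivSumPUnit (Fin m)).symm

lemma frame_none (h : IsEmbeddedData D S φ O ζ) (x : N)
    (e : Basis (Fin m) ℝ (TangentSpace (𝓡 m) x)) : h.frame x e none = ζ (φ x) := by
  simp [frame, frameEquiv_apply]

lemma frame_some (h : IsEmbeddedData D S φ O ζ) (x : N)
    (e : Basis (Fin m) ℝ (TangentSpace (𝓡 m) x)) (a : Fin m) :
    h.frame x e (some a) = mfderiv (𝓡 m) (𝓡 (m + 1)) φ x (e a) := by
  simp [frame, frameEquiv_apply]

/-- The covector `θ^a` of the basis `{ν, θ^a}` dual to `{ζ, e_a}`, raised with the metric. -/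
def theta (h : IsEmbeddedData D S φ O ζ) (x : N) (e : Basis (Fin m) ℝ (TangentSpace (𝓡 m) x))
    (a : Fin m) : TangentSpace (𝓡 (m + 1)) (φ x) :=
  S.sharp (φ x) ((h.frame x e).coord (some a))

/-- The normal covector of `φ(N)` at `φ(x)` that takes the value `1` on the rigging `ζ`: the
`ζ`-component with respect to `{e_a, ζ}`. -/
def normalCovec (h : IsEmbeddedData D S φ O ζ) (x : N) :
    Dual ℝ (TangentSpace (𝓡 (m + 1)) (φ x)) :=
  LinearMap.snd ℝ _ _ ∘ₗ (h.frameEquiv x).symm.toLinearMap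

lemma normalCovec_tangent (h : IsEmbeddedData D S φ O ζ) (x : N) (u : TangentSpace (𝓡 m) x) :
    h.normalCovec x (mfderiv (𝓡 m) (𝓡 (m + 1)) φ x u) = 0 := by
  have : mfderiv (𝓡 m) (𝓡 (m + 1)) φ x u = h.frameEquiv x (u, 0) := by simp [frameEquiv_apply]
  simp [normalCovec, this]

lemma normalCovec_rigging (h : IsEmbeddedData D S φ O ζ) (x : N) :
    h.normalCovec x (ζ (φ x)) = 1 := by
  have : ζ (φ x) = h.frameEquiv x (0, 1) := by simp [frameEquiv_apply]
  simp [normalCovec, this]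

/-- The normal vector field `ν` along `φ(N)`: the normal covector, raised with the metric. -/
def nu (h : IsEmbeddedData D S φ O ζ) (x : N) : TangentSpace (𝓡 (m + 1)) (φ x) :=
  S.sharp (φ x) (h.normalCovec x)

/-- The normal covector is the member of the basis dual to `{ζ, e_a}` that corresponds to `ζ`. -/
lemma coord_none (h : IsEmbeddedData D S φ O ζ) (x : N)
    (e : Basis (Fin m) ℝ (TangentSpace (𝓡 m) x)) :
    (h.frame x e).coord none = h.normalCovec x := by
  refine (h.frame x e).ext fun i ↦ ?_
  cases i with
  | none => rw [frame_none, normalCovec_rigging, ← h.frame_none x e]; simp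
  | some a => rw [frame_some, normalCovec_tangent, ← h.frame_some x e]; simp

/-! The transverse components `p`, `w`, `q` and the tensor `𝕴` of the deformation tensor `£_η g`. -/

/-- `p = φ^*(K(ζ,ζ))`, with `K = £_η g` -/
def p (_h : IsEmbeddedData D S φ O ζ) (η : VecField (𝓡 (m + 1)) (M := M)) : N → ℝ :=
  fun x ↦ S.deformation η (φ x) (ζ (φ x)) (ζ (φ x))

/-- `w = φ^*(K(ζ,ν))`, with `K = £_η g` -/
def w (h : IsEmbeddedData D S φ O ζ) (η : VecField (𝓡 (m + 1)) (M := M)) : N → ℝ :=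
  fun x ↦ S.deformation η (φ x) (ζ (φ x)) (h.nu x)

/-- `q = φ^*(K(ζ,·))`, with `K = £_η g` -/
def q (_h : IsEmbeddedData D S φ O ζ) (η : VecField (𝓡 (m + 1)) (M := M)) :
    CovecField (𝓡 m) (M := N) :=
  fun x ↦ (S.deformation η (φ x) (ζ (φ x))) ∘L mfderiv (𝓡 m) (𝓡 (m + 1)) φ x

/-- `𝕴 = ½ φ^*(£_ζ K)`, with `K = £_η g` -/
def II (_h : IsEmbeddedData D S φ O ζ) (η : VecField (𝓡 (m + 1)) (M := M)) (x : N)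
    (u v : TangentSpace (𝓡 m) x) : ℝ :=
  (1 / 2 : ℝ) * lieBilin ζ (S.deformation η) (φ x) (mfderiv (𝓡 m) (𝓡 (m + 1)) φ x u)
    (mfderiv (𝓡 m) (𝓡 (m + 1)) φ x v)

/-- `A_η = (£_η̄ ℓ)(n) - w` -/
def A (h : IsEmbeddedData D S φ O ζ) (η : VecField (𝓡 (m + 1)) (M := M))
    (etab : VecField (𝓡 m) (M := N)) : N → ℝ :=
  fun x ↦ lieCovec etab D.ell x (D.n x) - h.w η x

/-- `X_η = ½ (η̄(ℓ^{(2)}) - p) n + P(£_η̄ ℓ - q, ·)` -/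
def X (h : IsEmbeddedData D S φ O ζ) (η : VecField (𝓡 (m + 1)) (M := M))
    (etab : VecField (𝓡 m) (M := N)) : VecField (𝓡 m) (M := N) :=
  fun x ↦ (1 / 2 * (mvfderiv (𝓡 m) D.ell2 x (etab x) - h.p η x) : ℝ) • D.n x
    + D.P x (lieCovec etab D.ell x - h.q η x).toLinearMap

end IsEmbeddedData

end

/-! At a point of the hypersurface `η` is tangent and null, so it comes from a `γ`-null vector.
Since `γ` is positive semidefinite, such a vector lies in the radical, which is spanned by `n`.
Pairing with `ζ` gives the factor: `α = g(ζ,η)`, which is visibly smooth.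

The commutator is found from its metric products. Expanding `(£_η g)(ζ,·)` and `(£_η g)(ζ,ζ)` by the
Leibniz rule gives `g([η,ζ], φ_* u) = (£_η̄ ℓ - q)(u)` and `g([η,ζ],ζ) = ½ (η̄(ℓ^{(2)}) - p)`,
because brackets of `φ`-related fields are `φ`-related (`mlieBracket_of_related`). A vector along
the hypersurface is determined by these products (`ext_vector`). `A_η` and `X_η` are exactly what
the inverse `(P, n)` of the ambient form makes of them, once `ν = φ_* n` is known (`nu_eq`). The
same products prove smoothness: `£_η̄ ℓ - q` is the pull-back of a smooth covector field, and a
non-degenerate form turns smooth products into a smooth vector field.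

For the transport of `Y`, pull back `½ £_η £_ζ g = ½ £_ζ £_η g + ½ £_{[η,ζ]} g`
(`lieBilin_lieBilin_sub`). The left side is `£_η̄ Y`, since `η` is `φ`-related to `η̄`; the first
term on the right is `𝕴`. In the last term `[η,ζ] = A ζ + φ_* X` holds only on the hypersurface.
This suffices (`lieBilin_pullback_of_eq_add`): on tangent vectors, the derivatives of the field
enter `£_Z g` only through tangential derivatives of the products `g(Z,·)`.

The expanded form comes from `half_lieBilin_γ`, which rewrites `½ £_X γ` with the metric
hypersurface connection, applied to `γ(X,·) = β - A ℓ` with `β = dα + 2 α s - q`. The terms in `ℓ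
⊗_s dA` cancel, and the coefficient of `U` collapses to `½ (η̄(ℓ^{(2)}) - p)`. -/

open Bundle FiberBundle VectorField Module
open scoped Manifold ContDiff Topology

noncomputable section

set_option linter.unusedSectionVars false

/-! ### Pointwise smoothness of tensor fields and of their Lie derivatives -/

section Smoothness

variable {E : Type*} [NormedAddCommGroup E] [NormedSpace ℝ E] [FiniteDimensional ℝ E]
  {H : Type*} [TopologicalSpace H] {I : ModelWithCorners ℝ E H}
  {M : Type*} [TopologicalSpace M] [ChartedSpace H M] [IsManifold I ∞ M]
  {E' : Type*} [NormedAddCommGroup E'] [NormedSpace ℝ E']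
  {H' : Type*} [TopologicalSpace H'] {I' : ModelWithCorners ℝ E' H'}
  {M' : Type*} [TopologicalSpace M'] [ChartedSpace H' M'] [IsManifold I' ∞ M']
  {x : M}

/-- The vector field `X` is smooth at `x`. -/
abbrev VecField.SmoothAt (X : VecField I (M := M)) (x : M) : Prop := CMDiffAt ∞ (T% X) x

/-- The covector field `σ` is smooth at `x`. -/
def CovecField.SmoothAt (σ : CovecField I (M := M)) (x : M) : Prop :=
  ContMDiffAt I (I.prod 𝓘(ℝ, E →L[ℝ] ℝ)) ∞
    (fun y ↦ TotalSpace.mk' (E →L[ℝ] ℝ) (E := fun y : M ↦ TangentSpace I y →L[ℝ] ℝ) y (σ y)) x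

/-- The `(0,2)`-tensor field `T` is smooth at `x`. -/
def BilinField.SmoothAt (T : BilinField I (M := M)) (x : M) : Prop :=
  ContMDiffAt I (I.prod 𝓘(ℝ, E →L[ℝ] E →L[ℝ] ℝ)) ∞
    (fun y ↦ TotalSpace.mk' (E →L[ℝ] E →L[ℝ] ℝ)
      (E := fun y : M ↦ TangentSpace I y →L[ℝ] TangentSpace I y →L[ℝ] ℝ) y (T y)) x

/-- The formulas for `lieCovec` and `lieBilin` hold only at points where the fields are
differentiable. Differentiating such a formula again requires it on a whole neighbourhood. -/
lemma eventually_mdifferentiableAt_of_contMDiffAt {f : M → M'} (hf : ContMDiffAt I I' ∞ f x) :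
    ∀ᶠ y in 𝓝 x, MDifferentiableAt I I' f y := by
  have h1 : IsManifold I 1 M := inferInstance
  -- Passing from a point to a neighbourhood is done at a finite order; order one is all that
  -- differentiability needs.
  have h2 : ContMDiffAt I I' 1 f x := hf.of_le (by simp)
  filter_upwards [(contMDiffAt_iff_contMDiffAt_nhds (by simp)).1 h2] with y hy
  exact hy.mdifferentiableAt (by simp)

lemma VecField.SmoothAt.diffAt {X : VecField I (M := M)} (h : VecField.SmoothAt X x) :
    VecField.DiffAt X x := h.mdifferentiableAt (by simp)

lemma VecField.SmoothAt.eventually_diffAt {X : VecField I (M := M)} (h : VecField.SmoothAt X x) :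
    ∀ᶠ y in 𝓝 x, VecField.DiffAt X y := eventually_mdifferentiableAt_of_contMDiffAt h

lemma CovecField.SmoothAt.diffAt {σ : CovecField I (M := M)} (h : CovecField.SmoothAt σ x) :
    CovecField.DiffAt σ x := ContMDiffAt.mdifferentiableAt h (by simp)

lemma CovecField.SmoothAt.eventually_diffAt {σ : CovecField I (M := M)}
    (h : CovecField.SmoothAt σ x) : ∀ᶠ y in 𝓝 x, CovecField.DiffAt σ y :=
  eventually_mdifferentiableAt_of_contMDiffAt h

lemma BilinField.SmoothAt.diffAt {T : BilinField I (M := M)} (h : BilinField.SmoothAt T x) :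
    BilinField.DiffAt T x := ContMDiffAt.mdifferentiableAt h (by simp)

set_option synthInstance.maxHeartbeats 200000 in
lemma BilinField.SmoothAt.eventually_diffAt {T : BilinField I (M := M)}
    (h : BilinField.SmoothAt T x) : ∀ᶠ y in 𝓝 x, BilinField.DiffAt T y :=
  eventually_mdifferentiableAt_of_contMDiffAt h

lemma CovecField.SmoothAt.apply {σ : CovecField I (M := M)} {X : VecField I (M := M)}
    (hσ : CovecField.SmoothAt σ x) (hX : VecField.SmoothAt X x) :
    ContMDiffAt I 𝓘(ℝ) ∞ (fun y ↦ σ y (X y)) x := by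
  have : ContMDiffAt I (I.prod 𝓘(ℝ)) ∞
      (fun m ↦ TotalSpace.mk' ℝ (E := Bundle.Trivial M ℝ) m (σ m (X m))) x :=
    ContMDiffAt.clm_bundle_apply (F₁ := E) (b := fun y : M ↦ y) hσ hX
  exact (contMDiffAt_totalSpace.1 this).2

lemma BilinField.SmoothAt.apply {T : BilinField I (M := M)} {X : VecField I (M := M)}
    (hT : BilinField.SmoothAt T x) (hX : VecField.SmoothAt X x) :
    CovecField.SmoothAt (fun y ↦ T y (X y)) x :=
  ContMDiffAt.clm_bundle_apply (F₁ := E) (b := fun y : M ↦ y)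
    (E₂ := fun y : M ↦ TangentSpace I y →L[ℝ] ℝ) hT hX

lemma VecField.smoothAt_trivializationAt_symm (x : M) (a : E) :
    VecField.SmoothAt
      (fun y ↦ (trivializationAt E (TangentSpace I : M → Type _) x).symm y a) x := by
  let t := trivializationAt E (TangentSpace I : M → Type _) x
  refine (contMDiffAt_section x).2 ?_
  refine (contMDiffAt_const (c := a)).congr_of_eventuallyEq ?_
  filter_upwards [t.open_baseSet.mem_nhds (mem_baseSet_trivializationAt' x)] with y hy
  exact congr_arg Prod.snd (t.apply_mk_symm hy a)

/-- In finite dimension a linear map is a fixed linear expression in its values on a basis, so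
smoothness can be checked vector by vector. This reduces smoothness of tensor fields to that of
scalar functions. -/
lemma contMDiffAt_clm_of_apply {F : Type*} [NormedAddCommGroup F] [NormedSpace ℝ F]
    {L : M → E →L[ℝ] F} (h : ∀ a, ContMDiffAt I 𝓘(ℝ, F) ∞ (fun y ↦ L y a) x) :
    ContMDiffAt I 𝓘(ℝ, E →L[ℝ] F) ∞ L x := by
  let b := Module.finBasis ℝ E
  let c : Fin (finrank ℝ E) → E →L[ℝ] ℝ := fun i ↦ LinearMap.toContinuousLinearMap (b.coord i)
  have : L = fun y ↦ ∑ i, (ContinuousLinearMap.smulRightL ℝ E F (c i)) (L y (b i)) := by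
    ext y a
    have := congr(L y $(b.sum_repr a))
    simp only [map_sum, map_smul] at this
    simp [c, this]
  rw [this]
  refine ContMDiffAt.sum fun i _ ↦ ?_
  exact (ContinuousLinearMap.smulRightL ℝ E F (c i)).contDiff.contMDiff.contMDiffAt.comp x (h (b i))

/-- A covector field is smooth if it takes smooth values on smooth vector fields. -/
lemma CovecField.smoothAt_of_apply {σ : CovecField I (M := M)}
    (h : ∀ X : VecField I (M := M), VecField.SmoothAt X x →
      ContMDiffAt I 𝓘(ℝ) ∞ (fun y ↦ σ y (X y)) x) : CovecField.SmoothAt σ x := by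
  let t := trivializationAt E (TangentSpace I : M → Type _) x
  have ht : t.baseSet ∈ 𝓝 x := t.open_baseSet.mem_nhds (mem_baseSet_trivializationAt' x)
  refine (contMDiffAt_section x).2 (contMDiffAt_clm_of_apply fun a ↦ ?_)
  refine (h _ (VecField.smoothAt_trivializationAt_symm x a)).congr_of_eventuallyEq ?_
  filter_upwards [ht] with y hy
  simp only [hom_trivializationAt_apply]
  rw [ContinuousLinearMap.inCoordinates_eq hy (by simp)]
  simp

/-- A `(0,2)`-tensor field is smooth if it takes smooth values on smooth vector fields. -/
lemma BilinField.smoothAt_of_apply {T : BilinField I (M := M)}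
    (h : ∀ X Y : VecField I (M := M), VecField.SmoothAt X x → VecField.SmoothAt Y x →
      ContMDiffAt I 𝓘(ℝ) ∞ (fun y ↦ T y (X y) (Y y)) x) : BilinField.SmoothAt T x := by
  let t := trivializationAt E (TangentSpace I : M → Type _) x
  let S := trivializationAt (E →L[ℝ] ℝ) (fun y : M ↦ TangentSpace I y →L[ℝ] ℝ) x
  have ht : t.baseSet ∈ 𝓝 x := t.open_baseSet.mem_nhds (mem_baseSet_trivializationAt' x)
  refine (contMDiffAt_hom_bundle _).2 ⟨contMDiffAt_id,
    contMDiffAt_clm_of_apply fun a ↦ contMDiffAt_clm_of_apply fun b ↦ ?_⟩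
  refine (h _ _ (VecField.smoothAt_trivializationAt_symm x a)
    (VecField.smoothAt_trivializationAt_symm x b)).congr_of_eventuallyEq ?_
  filter_upwards [ht] with y hy
  have hy' : y ∈ S.baseSet := by simpa [S, t] using hy
  rw [ContinuousLinearMap.inCoordinates_eq hy hy']
  simp only [ContinuousLinearMap.coe_comp, ContinuousLinearEquiv.coe_coe, Function.comp_apply,
    Trivialization.continuousLinearEquivAt_apply]
  rw [hom_trivializationAt_apply, ContinuousLinearMap.inCoordinates_eq hy (by simp)]
  simp

/-- The push-forward of a smooth vector field is smooth along the map. -/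
lemma ContMDiffAt.mfderiv_vecField {f : M → M'} (hf : ContMDiffAt I I' ∞ f x)
    {X : VecField I (M := M)} (hX : VecField.SmoothAt X x) :
    ContMDiffAt I I'.tangent ∞
      (fun y ↦ (⟨f y, mfderiv I I' f y (X y)⟩ : TangentBundle I' M')) x :=
  ContMDiffAt.clm_apply_of_inCoordinates (b₁ := fun y ↦ y) (b₂ := f)
    (hf.mfderiv_const (m := ∞) (by simp)) hX hf

lemma ContMDiffAt.mvfderiv_vecField {F : Type*} [NormedAddCommGroup F] [NormedSpace ℝ F]
    {f : M → F} (hf : ContMDiffAt I 𝓘(ℝ, F) ∞ f x)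
    {X : VecField I (M := M)} (hX : VecField.SmoothAt X x) :
    ContMDiffAt I 𝓘(ℝ, F) ∞ (fun y ↦ mvfderiv I f y (X y)) x :=
  ((contMDiff_snd_tangentBundle_modelSpace F 𝓘(ℝ, F)).contMDiffAt).comp x (hf.mfderiv_vecField hX)

lemma VecField.SmoothAt.mlieBracket {X Y : VecField I (M := M)} (hX : VecField.SmoothAt X x)
    (hY : VecField.SmoothAt Y x) : VecField.SmoothAt (mlieBracket I X Y) x := by
  have := FiniteDimensional.complete ℝ E
  have : IsManifold I (((⊤ : ℕ∞) : ℕ∞ω) + 1) M := inferInstanceAs (IsManifold I ∞ M)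
  have : IsManifold I (minSmoothness ℝ 2) M := by
    rw [minSmoothness_of_isRCLikeNormedField]; infer_instance
  exact ContMDiffAt.mlieBracket_vectorField (m := ⊤) (n := ⊤) hX hY (by simp)

lemma VecField.SmoothAt.smul {f : M → ℝ} {X : VecField I (M := M)}
    (hf : ContMDiffAt I 𝓘(ℝ) ∞ f x) (hX : VecField.SmoothAt X x) :
    VecField.SmoothAt (fun y ↦ f y • X y) x := ContMDiffAt.smul_section hf hX

/-- On smooth arguments the Lie derivative is given near the point by derivatives of smooth
functions and by brackets, all of which are smooth. -/
lemma CovecField.SmoothAt.lieCovec {V : VecField I (M := M)} {σ : CovecField I (M := M)}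
    (hV : VecField.SmoothAt V x) (hσ : CovecField.SmoothAt σ x) :
    CovecField.SmoothAt (lieCovec V σ) x := by
  refine CovecField.smoothAt_of_apply fun X hX ↦ ?_
  refine (((hσ.apply hX).mvfderiv_vecField hV).sub
    (hσ.apply (hV.mlieBracket hX))).congr_of_eventuallyEq ?_
  filter_upwards [hσ.eventually_diffAt, hX.eventually_diffAt] with y h1 h2
  exact lieCovec_apply h1 h2

lemma BilinField.SmoothAt.lieBilin {V : VecField I (M := M)} {T : BilinField I (M := M)}
    (hV : VecField.SmoothAt V x) (hT : BilinField.SmoothAt T x) :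
    BilinField.SmoothAt (lieBilin V T) x := by
  refine BilinField.smoothAt_of_apply fun X Y hX hY ↦ ?_
  refine (((((hT.apply hX).apply hY).mvfderiv_vecField hV).sub
    ((hT.apply (hV.mlieBracket hX)).apply hY)).sub
    ((hT.apply hX).apply (hV.mlieBracket hY))).congr_of_eventuallyEq ?_
  filter_upwards [hT.eventually_diffAt, hX.eventually_diffAt, hY.eventually_diffAt] with y h1 h2 h3
  exact lieBilin_apply h1 h2 h3

lemma CovecField.smoothAt_mvfderiv {f : M → ℝ} (hf : ContMDiffAt I 𝓘(ℝ) ∞ f x) :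
    CovecField.SmoothAt (mvfderiv I f) x :=
  CovecField.smoothAt_of_apply fun _ hX ↦ hf.mvfderiv_vecField hX

end Smoothness

/-! ### Brackets as commutators of derivations, and vector fields related by an immersion -/

section RelatedFields

variable {E : Type*} [NormedAddCommGroup E] [NormedSpace ℝ E] [FiniteDimensional ℝ E]
  {H : Type*} [TopologicalSpace H] {I : ModelWithCorners ℝ E H} [I.Boundaryless]
  {M : Type*} [TopologicalSpace M] [ChartedSpace H M] [IsManifold I ∞ M]
  {E' : Type*} [NormedAddCommGroup E'] [NormedSpace ℝ E'] [FiniteDimensional ℝ E']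
  {H' : Type*} [TopologicalSpace H'] {I' : ModelWithCorners ℝ E' H'} [I'.Boundaryless]
  {M' : Type*} [TopologicalSpace M'] [ChartedSpace H' M'] [IsManifold I' ∞ M']
  {x : M}

lemma isManifold_minSmoothness : IsManifold I (minSmoothness ℝ 3) M := by
  rw [minSmoothness_of_isRCLikeNormedField]
  exact IsManifold.of_le (n := ∞) (by simp [← WithTop.coe_ofNat])

/-- The product rule produces `D²f(V,W)` and `D²f(W,V)` besides the bracket term; they cancel by
symmetry of the second derivative. -/
lemma fderiv_lieBracket {F : Type*} [NormedAddCommGroup F] [NormedSpace ℝ F] {f : E → F}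
    {V W : E → E} {z : E} (hf : ContDiffAt ℝ 2 f z) (hV : DifferentiableAt ℝ V z)
    (hW : DifferentiableAt ℝ W z) :
    fderiv ℝ f z (lieBracket ℝ V W z) = fderiv ℝ (fun y ↦ fderiv ℝ f y (W y)) z (V z)
      - fderiv ℝ (fun y ↦ fderiv ℝ f y (V y)) z (W z) := by
  have hf' : DifferentiableAt ℝ (fderiv ℝ f) z :=
    (hf.fderiv_right (m := 1) (by norm_num)).differentiableAt (by simp)
  have hs := (hf.isSymmSndFDerivAt (by simp)).eq (V z) (W z)
  rw [fderiv_clm_apply hf' hW, fderiv_clm_apply hf' hV]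
  simp [lieBracket, hs]

/-- `df([V,W]) = V(W(f)) - W(V(f))` -/
lemma mvfderiv_mlieBracket {F : Type*} [NormedAddCommGroup F] [NormedSpace ℝ F] {f : M → F}
    {V W : VecField I (M := M)} (hf : ContMDiffAt I 𝓘(ℝ, F) ∞ f x)
    (hV : VecField.SmoothAt V x) (hW : VecField.SmoothAt W x) :
    mvfderiv I f x (mlieBracket I V W x) = mvfderiv I (fun y ↦ mvfderiv I f y (W y)) x (V x)
      - mvfderiv I (fun y ↦ mvfderiv I f y (V y)) x (W x) := by
  have := FiniteDimensional.complete ℝ E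
  have : IsManifold I (minSmoothness ℝ 3) M := isManifold_minSmoothness
  -- Everything is transported to the model space by the inverse chart, where the bracket is
  -- explicit and `fderiv_lieBracket` applies.
  let ψ : E → M := (extChartAt I x).symm
  let z : E := extChartAt I x x
  have hz : ψ z = x := extChartAt_to_inv x
  have htar : ∀ᶠ y in 𝓝 z, y ∈ (extChartAt I x).target := extChartAt_target_mem_nhds x
  have hψ (y) (hy : y ∈ (extChartAt I x).target) : ContMDiffAt 𝓘(ℝ, E) I ∞ ψ y := by
    have h1 := contMDiffWithinAt_extChartAt_symm_range (I := I) (n := ∞) x hy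
    rwa [I.range_eq_univ] at h1
  have hψi (y) (hy : y ∈ (extChartAt I x).target) : (mfderiv 𝓘(ℝ, E) I ψ y).IsInvertible := by
    have := isInvertible_mfderivWithin_extChartAt_symm (I := I) hy
    rwa [I.range_eq_univ, mfderivWithin_univ] at this
  have hzt : z ∈ (extChartAt I x).target := mem_extChartAt_target x
  have hfz : ContMDiffAt I 𝓘(ℝ, F) ∞ f (ψ z) := by rwa [hz]
  have hfψ : ContDiffAt ℝ ∞ (f ∘ ψ) z := (hfz.comp z (hψ z hzt)).contDiffAt
  have hfnear : ∀ᶠ y in 𝓝 z, MDifferentiableAt I 𝓘(ℝ, F) f (ψ y) :=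
    (hψ z hzt).continuousAt.eventually (eventually_mdifferentiableAt_of_contMDiffAt hfz)
  have hpull (X : VecField I (M := M)) (y) (hy : y ∈ (extChartAt I x).target) :
      mfderiv 𝓘(ℝ, E) I ψ y (mpullback 𝓘(ℝ, E) I ψ X y) = X (ψ y) := by
    obtain ⟨e, he⟩ := hψi y hy
    simp [mpullback_apply, ← he]
  have hpd (X : VecField I (M := M)) (hX : VecField.SmoothAt X x) :
      DifferentiableAt ℝ (mpullback 𝓘(ℝ, E) I ψ X : E → E) z := by
    have h1 : VecField.DiffAt X (ψ z) := by rw [hz]; exact hX.diffAt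
    have h2 := MDifferentiableAt.mpullback_vectorField h1 (hψ z hzt) (hψi z hzt)
      (by simp [← WithTop.coe_ofNat])
    exact ((contMDiff_snd_tangentBundle_modelSpace E 𝓘(ℝ, E)).contMDiffAt.mdifferentiableAt
      one_ne_zero |>.comp z h2).differentiableAt
  -- This is an equality of germs and not only at `z`, because the derivative along a field is
  -- differentiated once more in `hder2`.
  have hder (X : VecField I (M := M)) : (fun y ↦ fderiv ℝ (f ∘ ψ) y (mpullback 𝓘(ℝ, E) I ψ X y))
      =ᶠ[𝓝 z] (fun y ↦ mvfderiv I f y (X y)) ∘ ψ := by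
    filter_upwards [htar, hfnear] with y hy hfy
    have h1 := mfderiv_comp_apply (I := 𝓘(ℝ, E)) y hfy ((hψ y hy).mdifferentiableAt (by simp))
      (mpullback 𝓘(ℝ, E) I ψ X y)
    rw [hpull X y hy, mfderiv_eq_fderiv] at h1
    exact h1
  have hder2 (X Y : VecField I (M := M)) (hX : VecField.SmoothAt X x) :
      fderiv ℝ (fun y ↦ fderiv ℝ (f ∘ ψ) y (mpullback 𝓘(ℝ, E) I ψ X y)) z
        (mpullback 𝓘(ℝ, E) I ψ Y z) = mvfderiv I (fun y ↦ mvfderiv I f y (X y)) x (Y x) := by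
    rw [(hder X).fderiv_eq]
    have h1 : MDifferentiableAt I 𝓘(ℝ, F) (fun y ↦ mvfderiv I f y (X y)) (ψ z) := by
      rw [hz]; exact (hf.mvfderiv_vecField hX).mdifferentiableAt (by simp)
    have h2 := mfderiv_comp_apply (I := 𝓘(ℝ, E)) z h1 ((hψ z hzt).mdifferentiableAt (by simp))
      (mpullback 𝓘(ℝ, E) I ψ Y z)
    rw [hpull Y z hzt, mfderiv_eq_fderiv] at h2
    refine h2.trans ?_
    rw [hz]; rfl
  have hbr : mpullback 𝓘(ℝ, E) I ψ (mlieBracket I V W) z =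
      lieBracket ℝ (mpullback 𝓘(ℝ, E) I ψ V) (mpullback 𝓘(ℝ, E) I ψ W) z := by
    have h1 : VecField.DiffAt V (ψ z) := by rw [hz]; exact hV.diffAt
    have h2 : VecField.DiffAt W (ψ z) := by rw [hz]; exact hW.diffAt
    rw [mpullback_mlieBracket h1 h2 (hψ z hzt) (by simp [← WithTop.coe_ofNat]),
      ← mlieBracketWithin_univ,
      mlieBracketWithin_eq_lieBracketWithin]
    exact congr_fun lieBracketWithin_univ z
  have key := fderiv_lieBracket (hfψ.of_le (by simp [← WithTop.coe_ofNat])) (hpd V hV) (hpd W hW)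
  rw [hder2 V W hV, hder2 W V hW] at key
  rw [← key, ← hbr, (hder (mlieBracket I V W)).eq_of_nhds, Function.comp_apply, hz]

/-- The chain rule `d(f ∘ φ)(X) = df(dφ X)` for functions on a manifold. -/
lemma mvfderiv_comp_apply' {F : Type*} [NormedAddCommGroup F] [NormedSpace ℝ F] {φ : M → M'}
    {f : M' → F} (hf : MDifferentiableAt I' 𝓘(ℝ, F) f (φ x)) (hφ : MDifferentiableAt I I' φ x)
    (u : TangentSpace I x) :
    mvfderiv I (fun y ↦ f (φ y)) x u = mvfderiv I' f (φ x) (mfderiv I I' φ x u) :=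
  mfderiv_comp_apply x hf hφ u

lemma mvfderiv_congr_of_eventuallyEq {F : Type*} [NormedAddCommGroup F] [NormedSpace ℝ F]
    {f g : M → F} (h : f =ᶠ[𝓝 x] g) (u : TangentSpace I x) :
    mvfderiv I f x u = mvfderiv I g x u :=
  congr((show E →L[ℝ] F from $(h.mfderiv_eq)) u)

/-- The Lie bracket of `φ`-related vector fields is `φ`-related. -/
lemma mlieBracket_of_related {φ : M → M'} (hφ : ContMDiffAt I I' ∞ φ x)
    {X Y : VecField I (M := M)} {X' Y' : VecField I' (M := M')}
    (hX : VecField.SmoothAt X x) (hY : VecField.SmoothAt Y x)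
    (hX' : VecField.SmoothAt X' (φ x)) (hY' : VecField.SmoothAt Y' (φ x))
    (hXX' : ∀ᶠ y in 𝓝 x, X' (φ y) = mfderiv I I' φ y (X y))
    (hYY' : ∀ᶠ y in 𝓝 x, Y' (φ y) = mfderiv I I' φ y (Y y)) :
    mlieBracket I' X' Y' (φ x) = mfderiv I I' φ x (mlieBracket I X Y x) := by
  -- A vector-valued test function whose differential is injective at `φ x`: two tangent vectors
  -- agree once they differentiate `f` alike, and on brackets this is the commutator of derivations.
  let f : M' → E' := extChartAt I' (φ x)
  have hf : ContMDiffAt I' 𝓘(ℝ, E') ∞ f (φ x) := contMDiffAt_extChartAt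
  have hφd := eventually_mdifferentiableAt_of_contMDiffAt hφ
  have hfd := hφ.continuousAt.eventually (eventually_mdifferentiableAt_of_contMDiffAt hf)
  have hinj : Function.Injective (mvfderiv I' f (φ x)) :=
    (isInvertible_mfderiv_extChartAt (I := I') (mem_extChartAt_source (φ x))).injective
  have hrel {Z : VecField I (M := M)} {Z' : VecField I' (M := M')}
      (hZ : ∀ᶠ y in 𝓝 x, Z' (φ y) = mfderiv I I' φ y (Z y)) :
      (fun y ↦ mvfderiv I (fun y ↦ f (φ y)) y (Z y)) =ᶠ[𝓝 x]
        fun y ↦ mvfderiv I' f (φ y) (Z' (φ y)) := by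
    filter_upwards [hφd, hfd, hZ] with y h1 h2 h3
    rw [mvfderiv_comp_apply' h2 h1, h3]
  have hXY {Z W : VecField I (M := M)} {Z' W' : VecField I' (M := M')}
      (hZ : ∀ᶠ y in 𝓝 x, Z' (φ y) = mfderiv I I' φ y (Z y))
      (hW : ∀ᶠ y in 𝓝 x, W' (φ y) = mfderiv I I' φ y (W y)) (hW' : VecField.SmoothAt W' (φ x)) :
      mvfderiv I (fun y ↦ mvfderiv I (fun y ↦ f (φ y)) y (W y)) x (Z x) =
        mvfderiv I' (fun y ↦ mvfderiv I' f y (W' y)) (φ x) (Z' (φ x)) := by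
    rw [mvfderiv_congr_of_eventuallyEq (hrel hW), hZ.self_of_nhds]
    exact mvfderiv_comp_apply' (f := fun y ↦ mvfderiv I' f y (W' y))
      ((hf.mvfderiv_vecField hW').mdifferentiableAt (by simp)) hφd.self_of_nhds _
  apply hinj
  rw [← mvfderiv_comp_apply' hfd.self_of_nhds hφd.self_of_nhds, mvfderiv_mlieBracket hf hX' hY',
    ← hXY hXX' hYY' hY', ← hXY hYY' hXX' hX']
  exact (mvfderiv_mlieBracket (hf.comp x hφ) hX hY).symm

/-- Stated for the whole maximal atlas because the charts in which an immersion is linear need not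
be the preferred ones. Without boundary the chart target is open, so both maps are smooth in the
unrestricted sense. -/
lemma contMDiffAt_extend_and_symm {e : OpenPartialHomeomorph M H}
    (he : e ∈ IsManifold.maximalAtlas I ∞ M) {y : M} (hy : y ∈ e.source) :
    ContMDiffAt I 𝓘(ℝ, E) ∞ (e.extend I) y ∧
      ContMDiffAt 𝓘(ℝ, E) I ∞ (e.extend I).symm (e.extend I y) := by
  have h : ContMDiffOn 𝓘(ℝ, E) I ∞ (e.extend I).symm (I '' e.target) := contMDiffOn_extend_symm he
  refine ⟨e.contMDiffAt_extend he hy, h.contMDiffAt ?_⟩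
  rw [← e.extend_target']
  exact e.isOpen_extend_target.mem_nhds ((e.extend I).map_source (by simpa using hy))

/-- The push-forward of a constant vector field under the inverse of a chart. -/
def chartField (I : ModelWithCorners ℝ E H) (e : OpenPartialHomeomorph M H) (a : E) :
    VecField I (M := M) :=
  fun y ↦ (mfderiv 𝓘(ℝ, E) I (e.extend I).symm (e.extend I y) a : E)

lemma smoothAt_chartField {e : OpenPartialHomeomorph M H}
    (he : e ∈ IsManifold.maximalAtlas I ∞ M) {y : M} (hy : y ∈ e.source) (a : E) :
    VecField.SmoothAt (chartField I e a) y := by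
  obtain ⟨h1, h2⟩ := contMDiffAt_extend_and_symm he hy
  have hc : VecField.SmoothAt (fun _ ↦ a : VecField 𝓘(ℝ, E) (M := E)) (e.extend I y) :=
    contMDiffAt_vectorSpace_iff_contDiffAt.2 contDiffAt_const
  have h3 := (h2.mfderiv_vecField hc).comp y h1
  refine h3.congr_of_eventuallyEq ?_
  -- The composite sits over `e⁻¹(e z)`, which equals `z` only on the chart source; the fibre
  -- vectors are the same element of `E`.
  have hmk (b c : M) (h : c = b) (v : E) :
      (⟨b, v⟩ : TangentBundle I M) = ⟨c, v⟩ := by rw [h]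
  filter_upwards [e.open_source.mem_nhds hy] with z hz
  exact hmk _ _ ((e.extend I).left_inv (by simpa using hz)) _

/-- Chain rule for `e⁻¹ ∘ e`, which is the identity near `y`. It selects the constant `a` for which
the field takes a prescribed value at the point. -/
lemma chartField_mvfderiv {e : OpenPartialHomeomorph M H}
    (he : e ∈ IsManifold.maximalAtlas I ∞ M) {y : M} (hy : y ∈ e.source) (u : TangentSpace I y) :
    chartField I e (mvfderiv I (e.extend I) y u) y = u := by
  obtain ⟨h1, h2⟩ := contMDiffAt_extend_and_symm he hy
  have h3 := mfderiv_comp_apply y (h2.mdifferentiableAt (by simp)) (h1.mdifferentiableAt (by simp)) u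
  have h4 : (e.extend I).symm ∘ (e.extend I) =ᶠ[𝓝 y] id := by
    filter_upwards [e.open_source.mem_nhds hy] with z hz
    exact (e.extend I).left_inv (by simpa using hz)
  refine h3.symm.trans ?_
  have h5 : (mfderiv I I ((e.extend I).symm ∘ (e.extend I)) y : E →L[ℝ] E) =
    ContinuousLinearMap.id ℝ E := h4.mfderiv_eq.trans mfderiv_id
  exact congr($h5 u)

/-- An immersion admits, through every tangent vector, a vector field that is related to a vector
field on the target. -/
lemma Manifold.IsImmersion.exists_related {φ : M → M'} (hφ : IsImmersion I I' ∞ φ)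
    (u : TangentSpace I x) :
    ∃ (X : VecField I (M := M)) (X' : VecField I' (M := M')), VecField.SmoothAt X x ∧
      VecField.SmoothAt X' (φ x) ∧ X x = u ∧
      ∀ᶠ y in 𝓝 x, X' (φ y) = mfderiv I I' φ y (X y) := by
  obtain ⟨F, _, _, hF⟩ := hφ
  have h := hF x
  let d := h.domChart
  let c := h.codChart
  have hd := h.domChart_mem_maximalAtlas
  have hc := h.codChart_mem_maximalAtlas
  let a : E := mvfderiv I (d.extend I) x u
  -- `L` is `φ` written in charts adapted to the immersion. Being linear, it carries the constant
  -- field `a` to the constant field `L a`, so the corresponding chart fields are related.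
  let L : E →L[ℝ] E' := h.equiv.toContinuousLinearMap ∘L ContinuousLinearMap.inl ℝ E F
  refine ⟨chartField I d a, chartField I' c (L a), smoothAt_chartField hd h.mem_domChart_source a,
    smoothAt_chartField hc h.mem_codChart_source _, chartField_mvfderiv hd h.mem_domChart_source u,
    ?_⟩
  filter_upwards [d.open_source.mem_nhds h.mem_domChart_source] with y hy
  have hφy : φ y ∈ c.source := h.source_subset_preimage_source hy
  obtain ⟨d1, d2⟩ := contMDiffAt_extend_and_symm hd hy
  obtain ⟨c1, c2⟩ := contMDiffAt_extend_and_symm hc hφy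
  have hleft : (d.extend I).symm (d.extend I y) = y := (d.extend I).left_inv (by simpa using hy)
  have htar : d.extend I y ∈ (d.extend I).target := (d.extend I).map_source (by simpa using hy)
  have hw : L (d.extend I y) = c.extend I' (φ y) := by
    have := h.writtenInCharts htar
    simp only [Function.comp_apply] at this
    change c.extend I' (φ ((d.extend I).symm (d.extend I y))) = _ at this
    rw [hleft] at this
    exact this.symm
  have hφ' : MDifferentiableAt I I' φ ((d.extend I).symm (d.extend I y)) := by
    rw [hleft]
    exact (hF y).contMDiffAt.mdifferentiableAt (by simp)
  have e1 := mfderiv_comp_apply (d.extend I y) hφ' (d2.mdifferentiableAt (by simp)) a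
  have c2' : MDifferentiableAt 𝓘(ℝ, E') I' (c.extend I').symm (L (d.extend I y)) := by
    rw [hw]
    exact c2.mdifferentiableAt (by simp)
  have e2 := mfderiv_comp_apply (d.extend I y) c2' L.mdifferentiableAt a
  have e3 : φ ∘ (d.extend I).symm =ᶠ[𝓝 (d.extend I y)] (c.extend I').symm ∘ L := by
    have hnear : (d.extend I).target ∈ 𝓝 (d.extend I y) := by
      have := d.extend_target_mem_nhdsWithin (I := I) hy
      rwa [I.range_eq_univ, nhdsWithin_univ] at this
    filter_upwards [hnear] with z hz
    have h1 := h.writtenInCharts hz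
    have h2 : (d.extend I).symm z ∈ d.source := by simpa using (d.extend I).map_target hz
    have h3 := (c.extend I').left_inv
      (by simpa using h.source_subset_preimage_source h2 : φ ((d.extend I).symm z) ∈ _)
    simp only [Function.comp_apply] at h1 ⊢
    rw [← h3]
    exact congr_arg _ h1
  have e4 : (mfderiv 𝓘(ℝ, E) I' (φ ∘ (d.extend I).symm) (d.extend I y) : E →L[ℝ] E') =
    mfderiv 𝓘(ℝ, E) I' ((c.extend I').symm ∘ L) (d.extend I y) := e3.mfderiv_eq
  have e5 := e1.symm.trans (congr($e4 a).trans e2)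
  rw [hleft, L.mfderiv_eq, hw] at e5
  exact e5.symm

end RelatedFields

/-! ### Commutation of Lie derivatives, and their pull-back along an immersion -/

section LieCalculus

variable {E : Type*} [NormedAddCommGroup E] [NormedSpace ℝ E] [FiniteDimensional ℝ E]
  {H : Type*} [TopologicalSpace H] {I : ModelWithCorners ℝ E H} [I.Boundaryless]
  {M : Type*} [TopologicalSpace M] [ChartedSpace H M] [IsManifold I ∞ M]
  {E' : Type*} [NormedAddCommGroup E'] [NormedSpace ℝ E'] [FiniteDimensional ℝ E']
  {H' : Type*} [TopologicalSpace H'] {I' : ModelWithCorners ℝ E' H'} [I'.Boundaryless]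
  {M' : Type*} [TopologicalSpace M'] [ChartedSpace H' M'] [IsManifold I' ∞ M']
  {x : M}

/-- Allows tensor identities at a point to be tested on fields that are smooth there, so that
brackets and iterated derivatives are available. The witness is constant in a trivialization. -/
lemma VecField.exists_smoothAt (u : TangentSpace I x) :
    ∃ X : VecField I (M := M), VecField.SmoothAt X x ∧ X x = u := by
  let t := trivializationAt E (TangentSpace I : M → Type _) x
  exact ⟨_, VecField.smoothAt_trivializationAt_symm x (t ⟨x, u⟩).2,
    t.symm_apply_apply_mk (mem_baseSet_trivializationAt' x) u⟩

lemma mvfderiv_sub_apply {f g : M → ℝ} (hf : MDifferentiableAt I 𝓘(ℝ) f x)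
    (hg : MDifferentiableAt I 𝓘(ℝ) g x) (u : TangentSpace I x) :
    mvfderiv I (fun y ↦ f y - g y) x u = mvfderiv I f x u - mvfderiv I g x u :=
  congr($(mvfderiv_sub hf hg) u)

lemma mvfderiv_add_apply {f g : M → ℝ} (hf : MDifferentiableAt I 𝓘(ℝ) f x)
    (hg : MDifferentiableAt I 𝓘(ℝ) g x) (u : TangentSpace I x) :
    mvfderiv I (fun y ↦ f y + g y) x u = mvfderiv I f x u + mvfderiv I g x u :=
  congr($(mvfderiv_add hf hg) u)

lemma mvfderiv_mul_apply {f g : M → ℝ} (hf : MDifferentiableAt I 𝓘(ℝ) f x)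
    (hg : MDifferentiableAt I 𝓘(ℝ) g x) (u : TangentSpace I x) :
    mvfderiv I (fun y ↦ f y * g y) x u = f x * mvfderiv I g x u + mvfderiv I f x u * g x := by
  rw [mvfderiv_fun_mul hf hg]
  simp [mul_comm]

/-- `V((£_W T)(X,Y))` in terms of Lie brackets. -/
lemma mvfderiv_lieBilin_apply {T : BilinField I (M := M)} (hT : BilinField.SmoothAt T x)
    {W X Y : VecField I (M := M)} (hW : VecField.SmoothAt W x) (hX : VecField.SmoothAt X x)
    (hY : VecField.SmoothAt Y x) (v : TangentSpace I x) :
    mvfderiv I (fun y ↦ lieBilin W T y (X y) (Y y)) x v =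
      mvfderiv I (fun y ↦ mvfderiv I (fun z ↦ T z (X z) (Y z)) y (W y)) x v
      - mvfderiv I (fun y ↦ T y (mlieBracket I W X y) (Y y)) x v
      - mvfderiv I (fun y ↦ T y (X y) (mlieBracket I W Y y)) x v := by
  have e : (fun y ↦ lieBilin W T y (X y) (Y y)) =ᶠ[𝓝 x] fun y ↦
      (mvfderiv I (fun z ↦ T z (X z) (Y z)) y (W y) - T y (mlieBracket I W X y) (Y y))
        - T y (X y) (mlieBracket I W Y y) := by
    filter_upwards [hT.eventually_diffAt, hX.eventually_diffAt, hY.eventually_diffAt]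
      with y h1 h2 h3
    exact lieBilin_apply h1 h2 h3
  have d1 := ((((hT.apply hX).apply hY).mvfderiv_vecField hW).mdifferentiableAt (by simp))
  have d2 := (((hT.apply (hW.mlieBracket hX)).apply hY).mdifferentiableAt (by simp))
  have d3 := (((hT.apply hX).apply (hW.mlieBracket hY)).mdifferentiableAt (by simp))
  have d12 : MDifferentiableAt I 𝓘(ℝ) (fun y ↦ mvfderiv I (fun z ↦ T z (X z) (Y z)) y (W y)
      - T y (mlieBracket I W X y) (Y y)) x := d1.sub d2
  rw [mvfderiv_congr_of_eventuallyEq e, mvfderiv_sub_apply d12 d3,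
    mvfderiv_sub_apply d1 d2]

/-- `£_V £_W T - £_W £_V T = £_{[V,W]} T` -/
lemma lieBilin_lieBilin_sub {T : BilinField I (M := M)} (hT : BilinField.SmoothAt T x)
    {V W : VecField I (M := M)} (hV : VecField.SmoothAt V x) (hW : VecField.SmoothAt W x)
    (u v : TangentSpace I x) :
    lieBilin V (lieBilin W T) x u v - lieBilin W (lieBilin V T) x u v =
      lieBilin (mlieBracket I V W) T x u v := by
  have := FiniteDimensional.complete ℝ E
  have : IsManifold I (minSmoothness ℝ 3) M := isManifold_minSmoothness
  obtain ⟨X, hX, rfl⟩ := VecField.exists_smoothAt u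
  obtain ⟨Y, hY, rfl⟩ := VecField.exists_smoothAt v
  have hT' := hT.diffAt
  -- The Jacobi identity handles the double brackets of each argument; the double derivative of
  -- `T(X,Y)` is handled by `mvfderiv_mlieBracket`, and the mixed terms cancel.
  have j (Z : VecField I (M := M)) (hZ : VecField.SmoothAt Z x) :=
    leibniz_identity_mlieBracket_apply (𝕜 := ℝ) (hV.of_le (by simp [← WithTop.coe_ofNat]))
      (hW.of_le (by simp [← WithTop.coe_ofNat])) (hZ.of_le (by simp [← WithTop.coe_ofNat]))
  rw [lieBilin_apply (hT.lieBilin hW).diffAt hX.diffAt hY.diffAt,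
    lieBilin_apply (hT.lieBilin hV).diffAt hX.diffAt hY.diffAt,
    lieBilin_apply hT' (hV.mlieBracket hX).diffAt hY.diffAt,
    lieBilin_apply hT' hX.diffAt (hV.mlieBracket hY).diffAt,
    lieBilin_apply hT' (hW.mlieBracket hX).diffAt hY.diffAt,
    lieBilin_apply hT' hX.diffAt (hW.mlieBracket hY).diffAt,
    lieBilin_apply hT' hX.diffAt hY.diffAt,
    mvfderiv_lieBilin_apply hT hW hX hY, mvfderiv_lieBilin_apply hT hV hX hY,
    mvfderiv_mlieBracket ((hT.apply hX).apply hY) hV hW, j X hX, j Y hY]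
  simp only [map_add, add_apply]
  ring

/-- The part `(£_Z T)(X,Y) - X(T(Z,Y)) - Y(T(X,Z))` of the Lie derivative `(£_Z T)(X,Y)`, which
depends on `Z` only through its value at the point. -/
def lieBilinRem (T : BilinField I (M := M)) (X Y : VecField I (M := M)) (x : M)
    (Z : VecField I (M := M)) : ℝ :=
  lieBilin Z T x (X x) (Y x) - mvfderiv I (fun y ↦ T y (Z y) (Y y)) x (X x)
    - mvfderiv I (fun y ↦ T y (X y) (Z y)) x (Y x)

/-- Replacing `Z` by `f Z` adds `df(X) T(Z,Y) + df(Y) T(X,Z)` to the Lie derivative, and the two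
subtracted derivatives produce exactly these terms. -/
lemma lieBilinRem_tensorial {T : BilinField I (M := M)} (hT : BilinField.DiffAt T x)
    {X Y : VecField I (M := M)} (hX : VecField.DiffAt X x) (hY : VecField.DiffAt Y x) :
    TensorialAt I E (lieBilinRem T X Y x) x where
  smul {f Z} hf hZ := by
    have h1 := mvfderiv_fun_mul hf ((hT.apply hZ).apply hY)
    have h2 := mvfderiv_fun_mul hf ((hT.apply hX).apply hZ)
    simp [lieBilinRem, lieBilin_smul hT hf hZ, h1, h2]
    ring
  add {Z Z'} hZ hZ' := by
    have h1 := mvfderiv_fun_add ((hT.apply hZ).apply hY) ((hT.apply hZ').apply hY)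
    have h2 := mvfderiv_fun_add ((hT.apply hX).apply hZ) ((hT.apply hX).apply hZ')
    simp [lieBilinRem, lieBilin_add hT hZ hZ', h1, h2]
    ring

section Pullback

variable {φ : M → M'} {T : BilinField I (M := M)} {T' : BilinField I' (M := M')}

/-- The derivative of `T(X,Y)` along a map, for `T = φ^* T'` and `φ`-related vector fields. -/
lemma mvfderiv_bilin_of_related (hφ : ContMDiffAt I I' ∞ φ x)
    (hT' : BilinField.DiffAt T' (φ x))
    (hTT' : ∀ y u v, T' (φ y) (mfderiv I I' φ y u) (mfderiv I I' φ y v) = T y u v)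
    {X Y : VecField I (M := M)} {X' Y' : VecField I' (M := M')}
    (hX' : VecField.DiffAt X' (φ x)) (hY' : VecField.DiffAt Y' (φ x))
    (hXX' : ∀ᶠ y in 𝓝 x, X' (φ y) = mfderiv I I' φ y (X y))
    (hYY' : ∀ᶠ y in 𝓝 x, Y' (φ y) = mfderiv I I' φ y (Y y)) (u : TangentSpace I x) :
    mvfderiv I' (fun y ↦ T' y (X' y) (Y' y)) (φ x) (mfderiv I I' φ x u) =
      mvfderiv I (fun y ↦ T y (X y) (Y y)) x u := by
  rw [← mvfderiv_comp_apply' ((hT'.apply hX').apply hY') (hφ.mdifferentiableAt (by simp))]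
  refine mvfderiv_congr_of_eventuallyEq ?_ u
  filter_upwards [hXX', hYY'] with y h1 h2
  rw [h1, h2, hTT']

/-- The Lie derivative commutes with pull-back: `£_V φ^*T' = φ^*(£_{V'} T')` for `φ`-related `V`
and `V'`. -/
lemma lieBilin_pullback (hφ : Manifold.IsImmersion I I' ∞ φ)
    (hT' : BilinField.DiffAt T' (φ x)) (hT : BilinField.DiffAt T x)
    (hTT' : ∀ y u v, T' (φ y) (mfderiv I I' φ y u) (mfderiv I I' φ y v) = T y u v)
    {V : VecField I (M := M)} {V' : VecField I' (M := M')}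
    (hV : VecField.SmoothAt V x) (hV' : VecField.SmoothAt V' (φ x))
    (hVV' : ∀ᶠ y in 𝓝 x, V' (φ y) = mfderiv I I' φ y (V y)) (u v : TangentSpace I x) :
    lieBilin V' T' (φ x) (mfderiv I I' φ x u) (mfderiv I I' φ x v) = lieBilin V T x u v := by
  -- With related arguments every term of the Leibniz formula, brackets included, pulls back
  -- separately.
  obtain ⟨X, X', hX, hX', rfl, hXX'⟩ := hφ.exists_related u
  obtain ⟨Y, Y', hY, hY', rfl, hYY'⟩ := hφ.exists_related v
  have hφx := hφ.contMDiff x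
  rw [← hXX'.self_of_nhds, ← hYY'.self_of_nhds, lieBilin_apply hT' hX'.diffAt hY'.diffAt,
    lieBilin_apply hT hX.diffAt hY.diffAt, mlieBracket_of_related hφx hV hX hV' hX' hVV' hXX',
    mlieBracket_of_related hφx hV hY hV' hY' hVV' hYY', hVV'.self_of_nhds,
    mvfderiv_bilin_of_related hφx hT' hTT' hX'.diffAt hY'.diffAt hXX' hYY',
    hXX'.self_of_nhds, hYY'.self_of_nhds, hTT', hTT']

/-- The pull-back of the Lie derivative along a vector field that decomposes as `A ζ + φ_* W` on
the image of `φ`. -/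
lemma lieBilin_pullback_of_eq_add (hφ : Manifold.IsImmersion I I' ∞ φ)
    (hT' : BilinField.DiffAt T' (φ x)) (hT : BilinField.DiffAt T x)
    (hTT' : ∀ y u v, T' (φ y) (mfderiv I I' φ y u) (mfderiv I I' φ y v) = T y u v)
    (hsymm : ∀ y u v, T' y u v = T' y v u)
    {ζ Z : VecField I' (M := M')} (hζ : VecField.DiffAt ζ (φ x)) (hZ : VecField.DiffAt Z (φ x))
    {σ : CovecField I (M := M)} (hσ : CovecField.DiffAt σ x)
    (hζσ : ∀ y u, T' (φ y) (ζ (φ y)) (mfderiv I I' φ y u) = σ y u)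
    {A : M → ℝ} {W : VecField I (M := M)} (hA : MDifferentiableAt I 𝓘(ℝ) A x)
    (hW : VecField.DiffAt W x)
    (hAW : ∀ y, Z (φ y) = A y • ζ (φ y) + mfderiv I I' φ y (W y)) (u v : TangentSpace I x) :
    lieBilin Z T' (φ x) (mfderiv I I' φ x u) (mfderiv I I' φ x v) =
      A x * lieBilin ζ T' (φ x) (mfderiv I I' φ x u) (mfderiv I I' φ x v)
      + σ x u * mvfderiv I A x v + mvfderiv I A x u * σ x v + lieBilin W T x u v := by
  obtain ⟨X, X', hX, hX', rfl, hXX'⟩ := hφ.exists_related u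
  obtain ⟨Y, Y', hY, hY', rfl, hYY'⟩ := hφ.exists_related v
  -- `W` has no given extension to the target, so `B` replaces it: it has the same value at `x` and
  -- is related to a field `B'`. Tensoriality of the remainder makes the value sufficient.
  obtain ⟨B, B', hB, hB', hBW, hBB'⟩ := hφ.exists_related (W x)
  have hφx := hφ.contMDiff x
  have hφd : MDifferentiableAt I I' φ x := hφx.mdifferentiableAt (by simp)
  have ten' := lieBilinRem_tensorial hT' hX'.diffAt hY'.diffAt
  have ten := lieBilinRem_tensorial hT hX.diffAt hY.diffAt
  -- `A` lives on the source only and is frozen at its value at `x`. Its derivative is recovered in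
  -- `e1`, from the derivatives of the products with `Z`.
  have hc : MDifferentiableAt I' 𝓘(ℝ) (fun _ : M' ↦ A x) (φ x) := mdifferentiableAt_const
  have hcζ : VecField.DiffAt ((fun _ : M' ↦ A x) • ζ) (φ x) := hc.smul_section hζ
  have r1 : lieBilinRem T' X' Y' (φ x) Z =
      A x * lieBilinRem T' X' Y' (φ x) ζ + lieBilinRem T' X' Y' (φ x) B' := by
    rw [ten'.pointwise (σ' := (fun _ : M' ↦ A x) • ζ + B') hZ
      (mdifferentiableAt_add_section hcζ hB'.diffAt), ten'.add hcζ hB'.diffAt, ten'.smul hc hζ]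
    · rfl
    · simp [hAW x, hBB'.self_of_nhds, hBW]
  have r2 : lieBilinRem T X Y x B = lieBilinRem T X Y x W := ten.pointwise hB.diffAt hW hBW
  -- The direction of differentiation is tangent to the image, so only the values of `Z` on the
  -- image matter; the product rule yields the `dA` terms.
  have e1 (Q : VecField I (M := M)) (Q' : VecField I' (M := M')) (hQ : VecField.DiffAt Q x)
      (hQ' : VecField.DiffAt Q' (φ x))
      (hQQ' : ∀ᶠ y in 𝓝 x, Q' (φ y) = mfderiv I I' φ y (Q y)) (w : TangentSpace I x) :
      mvfderiv I' (fun y ↦ T' y (Z y) (Q' y)) (φ x) (mfderiv I I' φ x w) =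
        A x * mvfderiv I (fun y ↦ σ y (Q y)) x w + mvfderiv I A x w * σ x (Q x)
          + mvfderiv I (fun y ↦ T y (W y) (Q y)) x w := by
    have d1 : MDifferentiableAt I 𝓘(ℝ) (fun y ↦ A y * σ y (Q y)) x := hA.mul (hσ.apply hQ)
    rw [← mvfderiv_comp_apply' ((hT'.apply hZ).apply hQ') hφd,
      ← mvfderiv_mul_apply hA (hσ.apply hQ), ← mvfderiv_add_apply d1 ((hT.apply hW).apply hQ)]
    refine mvfderiv_congr_of_eventuallyEq ?_ w
    filter_upwards [hQQ'] with y h1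
    rw [hAW, h1, map_add, map_smul, add_apply, smul_apply, hζσ, hTT']
    rfl
  have e2 (Q : VecField I (M := M)) (Q' : VecField I' (M := M')) (hQ' : VecField.DiffAt Q' (φ x))
      (hQQ' : ∀ᶠ y in 𝓝 x, Q' (φ y) = mfderiv I I' φ y (Q y)) (w : TangentSpace I x) :
      mvfderiv I' (fun y ↦ T' y (ζ y) (Q' y)) (φ x) (mfderiv I I' φ x w) =
        mvfderiv I (fun y ↦ σ y (Q y)) x w := by
    rw [← mvfderiv_comp_apply' ((hT'.apply hζ).apply hQ') hφd]
    refine mvfderiv_congr_of_eventuallyEq ?_ w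
    filter_upwards [hQQ'] with y h1
    rw [h1, hζσ]
  -- For related fields the Lie derivative and both subtracted derivatives pull back.
  have r3 : lieBilinRem T' X' Y' (φ x) B' = lieBilinRem T X Y x B := by
    have := lieBilin_pullback hφ hT' hT hTT' hB hB' hBB' (X x) (Y x)
    simp only [lieBilinRem, hXX'.self_of_nhds, hYY'.self_of_nhds]
    rw [this, mvfderiv_bilin_of_related hφx hT' hTT' hB'.diffAt hY'.diffAt hBB' hYY',
      mvfderiv_bilin_of_related hφx hT' hTT' hX'.diffAt hB'.diffAt hXX' hBB']
  have hTs (y u v) : T y u v = T y v u := by rw [← hTT', hsymm, hTT']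
  rw [r3, r2] at r1
  have s1 : (fun y ↦ T' y (X' y) (Z y)) = fun y ↦ T' y (Z y) (X' y) := by ext; rw [hsymm]
  have s2 : (fun y ↦ T' y (X' y) (ζ y)) = fun y ↦ T' y (ζ y) (X' y) := by ext; rw [hsymm]
  have s3 : (fun y ↦ T y (X y) (W y)) = fun y ↦ T y (W y) (X y) := by ext; rw [hTs]
  simp only [lieBilinRem, hXX'.self_of_nhds, hYY'.self_of_nhds] at r1
  rw [s1, s2, s3, e1 Y Y' hY.diffAt hY'.diffAt hYY', e1 X X' hX.diffAt hX'.diffAt hXX',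
    e2 Y Y' hY'.diffAt hYY', e2 X X' hX'.diffAt hXX'] at r1
  linear_combination r1

end Pullback

end LieCalculus

/-! ### Smoothness by inverting a bilinear form, and pull-back of covector fields -/

section Inversion

variable {E : Type*} [NormedAddCommGroup E] [NormedSpace ℝ E] [FiniteDimensional ℝ E]
  {H : Type*} [TopologicalSpace H] {I : ModelWithCorners ℝ E H}
  {M : Type*} [TopologicalSpace M] [ChartedSpace H M] [IsManifold I ∞ M]
  {E' : Type*} [NormedAddCommGroup E'] [NormedSpace ℝ E'] [FiniteDimensional ℝ E']
  {H' : Type*} [TopologicalSpace H'] {I' : ModelWithCorners ℝ E' H'}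
  {M' : Type*} [TopologicalSpace M'] [ChartedSpace H' M'] [IsManifold I' ∞ M']
  {x : M}

/-- A vector field is smooth if the covector field associated with it by a smooth non-degenerate
bilinear form is smooth. -/
lemma VecField.smoothAt_of_bilin {B : BilinField I (M := M)} (hB : BilinField.SmoothAt B x)
    (hinj : ∀ y u, B y u = 0 → u = 0) {X : VecField I (M := M)}
    (hX : CovecField.SmoothAt (fun y ↦ B y (X y)) x) : VecField.SmoothAt X x := by
  have := FiniteDimensional.complete ℝ E
  let t := trivializationAt E (TangentSpace I : M → Type _) x
  let T := trivializationAt (E →L[ℝ] ℝ) (fun y : M ↦ TangentSpace I y →L[ℝ] ℝ) x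
  let G : M → E →L[ℝ] E →L[ℝ] ℝ := fun y ↦ ContinuousLinearMap.inCoordinates E
    (TangentSpace I : M → Type _) (E →L[ℝ] ℝ) (fun y : M ↦ TangentSpace I y →L[ℝ] ℝ) x y x y (B y)
  have hG : ContMDiffAt I 𝓘(ℝ, E →L[ℝ] E →L[ℝ] ℝ) ∞ G x := ((contMDiffAt_hom_bundle _).1 hB).2
  have hlam : ContMDiffAt I 𝓘(ℝ, E →L[ℝ] ℝ) ∞ (fun y ↦ (T ⟨y, B y (X y)⟩).2) x :=
    (contMDiffAt_section x).1 hX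
  have hT (y : M) (hy : y ∈ t.baseSet) : y ∈ T.baseSet := by simpa [T, t] using hy
  have hGX (y : M) (hy : y ∈ t.baseSet) : G y (t ⟨y, X y⟩).2 = (T ⟨y, B y (X y)⟩).2 := by
    simp only [G]
    rw [ContinuousLinearMap.inCoordinates_eq hy (hT y hy)]
    simp [t, T, t.symm_apply_apply_mk hy]
  have hGinj (y : M) (hy : y ∈ t.baseSet) : Function.Injective (G y) := by
    rw [injective_iff_map_eq_zero]
    intro a ha
    simp only [G] at ha
    rw [ContinuousLinearMap.inCoordinates_eq hy (hT y hy)] at ha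
    exact (t.continuousLinearEquivAt ℝ y hy).symm.map_eq_zero_iff.1
      (hinj y _ ((T.continuousLinearEquivAt ℝ y (hT y hy)).map_eq_zero_iff.1 ha))
  have hfin : finrank ℝ E = finrank ℝ (E →L[ℝ] ℝ) := by
    rw [← (LinearMap.toContinuousLinearMap : (E →ₗ[ℝ] ℝ) ≃ₗ[ℝ] _).finrank_eq]
    exact Subspace.dual_finrank_eq.symm
  have hequiv (y : M) (hy : y ∈ t.baseSet) : ∃ e : E ≃L[ℝ] (E →L[ℝ] ℝ), e = G y :=
    ⟨(LinearMap.linearEquivOfInjective (G y).toLinearMap (hGinj y hy)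
      hfin).toContinuousLinearEquiv, by ext; rfl⟩
  have hx : x ∈ t.baseSet := mem_baseSet_trivializationAt' x
  obtain ⟨e, he⟩ := hequiv x hx
  -- In coordinates `X` is `G⁻¹` applied to `B(X,·)`, and inversion is smooth at an invertible map.
  have hinv : ContDiffAt ℝ ∞ ContinuousLinearMap.inverse (G x) := he ▸ contDiffAt_map_inverse e
  refine (contMDiffAt_section x).2
    (((hinv.contMDiffAt.comp x hG).clm_apply hlam).congr_of_eventuallyEq ?_)
  filter_upwards [t.open_baseSet.mem_nhds hx] with y hy
  obtain ⟨e, he⟩ := hequiv y hy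
  simp only [Function.comp_apply]
  rw [← hGX y hy, ← he, ContinuousLinearMap.inverse_equiv]
  simp [t]

/-- The pull-back of a smooth covector field takes smooth values on smooth vector fields. -/
lemma CovecField.SmoothAt.contMDiffAt_pullback {φ : M → M'} (hφ : ContMDiffAt I I' ∞ φ x)
    {σ : CovecField I' (M := M')} (hσ : CovecField.SmoothAt σ (φ x)) {X : VecField I (M := M)}
    (hX : VecField.SmoothAt X x) :
    ContMDiffAt I 𝓘(ℝ) ∞ (fun y ↦ σ (φ y) (mfderiv I I' φ y (X y))) x := by
  have h1 : ContMDiffAt I (I'.prod 𝓘(ℝ, E' →L[ℝ] ℝ)) ∞ (fun y ↦ TotalSpace.mk' (E' →L[ℝ] ℝ)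
      (E := fun y : M' ↦ TangentSpace I' y →L[ℝ] Bundle.Trivial M' ℝ y) (φ y) (σ (φ y))) x :=
    ContMDiffAt.comp x hσ hφ
  have : ContMDiffAt I (I'.prod 𝓘(ℝ)) ∞ (fun m ↦ TotalSpace.mk' ℝ (E := Bundle.Trivial M' ℝ) (φ m)
      (σ (φ m) (mfderiv I I' φ m (X m)))) x :=
    ContMDiffAt.clm_bundle_apply (F₁ := E') (b := φ) h1 (hφ.mfderiv_vecField hX)
  exact (contMDiffAt_totalSpace.1 this).2

end Inversion

/-! ### Null vectors, the tensors `s`, `U`, `F`, and `£_W γ` in terms of the connection -/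

namespace NullMetricHypersurfaceData

variable {m : ℕ} {N : Type*} [TopologicalSpace N] [ChartedSpace (EuclideanSpace ℝ (Fin m)) N]
  [IsManifold (𝓡 m) ∞ N] (D : NullMetricHypersurfaceData m N)

/-- A null vector is a multiple of `n`. -/
lemma eq_smul_n_of_null {x : N} {u : TangentSpace (𝓡 m) x} (hu : D.γ x u u = 0) :
    u = D.ell x u • D.n x := by
  have h0 : D.γ x u = 0 := by
    ext v
    by_contra hv
    replace hv : D.γ x u v ≠ 0 := hv
    -- If `γ(u,v) ≠ 0`, then `γ(v + t u, v + t u) = γ(v,v) + 2 t γ(u,v)` is affine in `t`; the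
    -- chosen `t` gives it the value `-1`, against positivity.
    have h1 := D.γ_nonneg x (v + (-(D.γ x v v + 1) / (2 * D.γ x u v)) • u)
    simp only [map_add, map_smul, add_apply, smul_apply, hu, smul_eq_mul, D.γ_symm x v u] at h1
    have h2 : (-(D.γ x v v + 1) / (2 * D.γ x u v)) * D.γ x u v = -(D.γ x v v + 1) / 2 := by
      field_simp
    nlinarith
  have h1 := D.P_γ x u
  rw [h0, ContinuousLinearMap.toLinearMap_zero, map_zero] at h1
  exact (sub_eq_zero.1 h1.symm)

/-- A vector field `X` is smooth if `γ(X,·)` and `ℓ(X)` are. -/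
lemma smoothAt_of_γ_ell {x : N} {X : VecField (𝓡 m) (M := N)}
    (hγ : CovecField.SmoothAt (fun y ↦ D.γ y (X y)) x)
    (hl : ContMDiffAt (𝓡 m) 𝓘(ℝ) ∞ (fun y ↦ D.ell y (X y)) x) : VecField.SmoothAt X x := by
  have hell : CovecField.SmoothAt D.ell x := D.ell_smooth x
  have hγ' : BilinField.SmoothAt D.γ x := D.γ_smooth x
  -- The degenerate `γ` is completed to the non-degenerate form `γ + ℓ ⊗ ℓ`, whose product with `X`
  -- is `γ(X,·) + ℓ(X) ℓ`.
  refine VecField.smoothAt_of_bilin (B := fun y ↦ D.γ y + (D.ell y).smulRight (D.ell y)) ?_ ?_ ?_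
  · exact BilinField.smoothAt_of_apply fun Y Z hY hZ ↦
      ((hγ'.apply hY).apply hZ).add ((hell.apply hY).mul (hell.apply hZ))
  · intro y u hu
    have h1 (v) : D.γ y u v + D.ell y u * D.ell y v = 0 := congr($hu v)
    -- Testing on `n` isolates `ℓ(u)`, since `γ(·,n) = 0` and `ℓ(n) = 1`.
    have h2 := h1 (D.n y)
    rw [D.γ_symm, D.γ_n, D.ell_n] at h2
    replace h2 : D.ell y u = 0 := by simpa using h2
    refine (D.nondegenerate y u 0 fun v b ↦ ?_).1
    linear_combination h1 v + (b - D.ell y v) * h2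
  · exact CovecField.smoothAt_of_apply fun Y hY ↦ (hγ.apply hY).add (hl.mul (hell.apply hY))

lemma n_smoothAt (x : N) : VecField.SmoothAt D.n x := D.n_smooth x

/-- Cartan's formula for `£_n ℓ`, in which the term `d(ℓ(n))` vanishes because `ℓ(n) = 1`.
Smoothness of `s` and the value of `s(n)` follow. -/
lemma two_s_apply (x : N) (u : TangentSpace (𝓡 m) x) : 2 * D.s x u = lieCovec D.n D.ell x u := by
  obtain ⟨X, hX, rfl⟩ := VecField.exists_smoothAt u
  have h1 : (fun y ↦ D.ell y (D.n y)) = fun _ ↦ (1 : ℝ) := by ext y; exact D.ell_n y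
  simp only [s, F, smul_apply]
  rw [extDerivCovec_apply (D.ell_diffAt x) (D.n_smoothAt x).diffAt hX.diffAt,
    lieCovec_apply (D.ell_diffAt x) hX.diffAt, h1, mvfderiv_const]
  simp

lemma s_smoothAt (x : N) : CovecField.SmoothAt D.s x := by
  refine CovecField.smoothAt_of_apply fun X hX ↦ ?_
  have h1 : (fun y ↦ D.s y (X y)) = fun y ↦ (1 / 2 : ℝ) * lieCovec D.n D.ell y (X y) := by
    ext y
    rw [← two_s_apply]
    ring
  have h2 : CovecField.SmoothAt (lieCovec D.n D.ell) x :=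
    CovecField.SmoothAt.lieCovec (D.n_smoothAt x) (D.ell_smooth x)
  rw [h1]
  exact contMDiffAt_const.mul (h2.apply hX)

lemma s_n (x : N) : D.s x (D.n x) = 0 := by
  have h1 := D.two_s_apply x (D.n x)
  have h2 : (fun y ↦ D.ell y (D.n y)) = fun _ ↦ (1 : ℝ) := by ext y; exact D.ell_n y
  rw [lieCovec_apply (D.ell_diffAt x) (D.n_smoothAt x).diffAt, h2, mvfderiv_const] at h1
  simpa using h1

lemma U_symm (x : N) (u v : TangentSpace (𝓡 m) x) : D.U x u v = D.U x v u := by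
  obtain ⟨X, hX, rfl⟩ := VecField.exists_smoothAt u
  obtain ⟨Y, hY, rfl⟩ := VecField.exists_smoothAt v
  have h1 : (fun y ↦ D.γ y (Y y) (X y)) = fun y ↦ D.γ y (X y) (Y y) := by
    ext y; rw [D.γ_symm]
  simp only [U, smul_apply, lieBilin_apply (D.γ_diffAt x) hX.diffAt hY.diffAt,
    lieBilin_apply (D.γ_diffAt x) hY.diffAt hX.diffAt, h1, D.γ_symm x (Y x),
    D.γ_symm x (mlieBracket _ _ Y x)]
  ring_nf

lemma F_antisymm (x : N) (u v : TangentSpace (𝓡 m) x) : D.F x u v = - D.F x v u := by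
  obtain ⟨X, hX, rfl⟩ := VecField.exists_smoothAt u
  obtain ⟨Y, hY, rfl⟩ := VecField.exists_smoothAt v
  simp only [F, smul_apply, extDerivCovec_apply (D.ell_diffAt x) hX.diffAt hY.diffAt,
    extDerivCovec_apply (D.ell_diffAt x) hY.diffAt hX.diffAt, smul_eq_mul]
  rw [mlieBracket_swap_apply (V := Y) (W := X), map_neg]
  ring

lemma metricConnection_torsion_free {x : N} {X Y : VecField (𝓡 m) (M := N)}
    (hX : VecField.DiffAt X x) (hY : VecField.DiffAt Y x) :
    D.metricConnection Y x (X x) - D.metricConnection X x (Y x) = mlieBracket (𝓡 m) X Y x :=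
  D.metricConnection.torsion_eq_zero_iff.1
    D.metricConnection_isMetricHypersurfaceConnection.torsion_free hX hY

/-- The Hessian is symmetric. -/
lemma covDerivCovec_mvfderiv_symm {x : N} {f : N → ℝ} (hf : ContMDiffAt (𝓡 m) 𝓘(ℝ) ∞ f x)
    (u v : TangentSpace (𝓡 m) x) :
    covDerivCovec D.metricConnection (mvfderiv (𝓡 m) f) x u v =
      covDerivCovec D.metricConnection (mvfderiv (𝓡 m) f) x v u := by
  obtain ⟨X, hX, rfl⟩ := VecField.exists_smoothAt u
  obtain ⟨Y, hY, rfl⟩ := VecField.exists_smoothAt v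
  have hd := (CovecField.smoothAt_mvfderiv hf).diffAt
  -- The antisymmetric part of the Hessian compares `df([X,Y])` with `df(∇_X Y - ∇_Y X)`, which
  -- agree without torsion.
  have h1 := mvfderiv_mlieBracket hf hX hY
  rw [← D.metricConnection_torsion_free hX.diffAt hY.diffAt, map_sub] at h1
  rw [covDerivCovec_apply hd hX.diffAt hY.diffAt, covDerivCovec_apply hd hY.diffAt hX.diffAt]
  linear_combination -h1

/-- `½ £_W γ = ∇_(a β_b) - ℓ_(a ∇_b) A + (ℓ^{(2)} A + ℓ(W)) U` if `γ(W,·) = β - A ℓ`. -/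
lemma half_lieBilin_γ {x : N} {W : VecField (𝓡 m) (M := N)} {β : CovecField (𝓡 m) (M := N)}
    {A : N → ℝ} (hW : VecField.DiffAt W x) (hβ : CovecField.DiffAt β x)
    (hA : MDifferentiableAt (𝓡 m) 𝓘(ℝ) A x)
    (h : ∀ y u, D.γ y (W y) u = β y u - A y * D.ell y u) (u v : TangentSpace (𝓡 m) x) :
    1 / 2 * lieBilin W D.γ x u v =
      1 / 2 * (covDerivCovec D.metricConnection β x u v + covDerivCovec D.metricConnection β x v u)
      - 1 / 2 * (D.ell x u * mvfderiv (𝓡 m) A x v + mvfderiv (𝓡 m) A x u * D.ell x v)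
      + (D.ell2 x * A x + D.ell x (W x)) * D.U x u v := by
  obtain ⟨X, hX, rfl⟩ := VecField.exists_smoothAt u
  obtain ⟨Y, hY, rfl⟩ := VecField.exists_smoothAt v
  have hX := hX.diffAt
  have hY := hY.diffAt
  have hell := D.ell_diffAt x
  have hcon := D.metricConnection_isMetricHypersurfaceConnection
  -- In the combination `∇_W γ(X,Y) - ∇_X γ(W,Y) - ∇_Y γ(W,X)` the terms with `U(W,·)` cancel and `2
  -- ℓ(W) U(X,Y)` survives.
  have c1 := hcon.nabla_γ x W X Y hW hX hY
  have c2 := hcon.nabla_γ x X W Y hX hW hY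
  have c3 := hcon.nabla_γ x Y W X hY hW hX
  -- In the sum of `l1` and `l2` the tensor `F` drops out by antisymmetry, leaving `-2 ℓ^{(2)} U`;
  -- this is the source of the term `ℓ^{(2)} A U`.
  have l1 := hcon.nabla_ell x (X x) (Y x)
  have l2 := hcon.nabla_ell x (Y x) (X x)
  rw [covDerivCovec_apply hell hX hY] at l1
  rw [covDerivCovec_apply hell hY hX] at l2
  have e (Q : VecField (𝓡 m) (M := N)) (hQ : VecField.DiffAt Q x) (w : TangentSpace (𝓡 m) x) :
      mvfderiv (𝓡 m) (fun y ↦ D.γ y (W y) (Q y)) x w = mvfderiv (𝓡 m) (fun y ↦ β y (Q y)) x w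
        - (A x * mvfderiv (𝓡 m) (fun y ↦ D.ell y (Q y)) x w
          + mvfderiv (𝓡 m) A x w * D.ell x (Q x)) := by
    have d1 : MDifferentiableAt (𝓡 m) 𝓘(ℝ) (fun y ↦ A y * D.ell y (Q y)) x :=
      hA.mul (hell.apply hQ)
    simp only [h]
    rw [mvfderiv_sub_apply (hβ.apply hQ) d1, mvfderiv_mul_apply hA (hell.apply hQ)]
  rw [e Y hY] at c2
  rw [e X hX] at c3
  rw [lieBilin_apply (D.γ_diffAt x) hX hY, covDerivCovec_apply hβ hX hY,
    covDerivCovec_apply hβ hY hX, ← D.metricConnection_torsion_free hW hX,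
    ← D.metricConnection_torsion_free hW hY]
  have w1 := h x (D.metricConnection Y x (X x))
  have w2 := h x (D.metricConnection X x (Y x))
  simp only [map_sub, sub_apply]
  rw [D.γ_symm x (X x) (D.metricConnection W x (Y x))]
  rw [D.U_symm x (Y x) (W x), D.U_symm x (Y x) (X x)] at c3
  rw [D.U_symm x (X x) (W x)] at c2
  rw [D.F_antisymm x (Y x), D.U_symm x (Y x) (X x)] at l2
  linear_combination (1 / 2) * (c1 - c2 - c3) - (1 / 2) * (w1 + w2) - A x / 2 * (l1 + l2)

/-- `£_{α n} ℓ = dα + 2 α s` -/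
lemma lieCovec_smul_n_ell {x : N} {α : N → ℝ} (hα : MDifferentiableAt (𝓡 m) 𝓘(ℝ) α x)
    (u : TangentSpace (𝓡 m) x) :
    lieCovec (fun y ↦ α y • D.n y) D.ell x u = mvfderiv (𝓡 m) α x u + 2 * α x * D.s x u := by
  refine (lieCovec_smul (D.ell_diffAt x) hα (D.n_smoothAt x).diffAt u).trans ?_
  rw [D.ell_n, ← D.two_s_apply]
  ring

end NullMetricHypersurfaceData

/-! ### Embedded data: the normal vector and null tangent fields -/

namespace IsEmbeddedData

variable {m : ℕ} {N : Type*} [TopologicalSpace N] [ChartedSpace (EuclideanSpace ℝ (Fin m)) N]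
  [IsManifold (𝓡 m) ∞ N] {M : Type*} [TopologicalSpace M]
  [ChartedSpace (EuclideanSpace ℝ (Fin (m + 1))) M] [IsManifold (𝓡 (m + 1)) ∞ M]
  {D : NullHypersurfaceData m N} {S : LorentzianMetric m M} {φ : N → M} {O : Set M}
  {ζ η : VecField (𝓡 (m + 1)) (M := M)} {etab : VecField (𝓡 m) (M := N)} {x : N}

lemma g_smoothAt (S : LorentzianMetric m M) (y : M) : BilinField.SmoothAt S.g y := S.g_smooth y

lemma φ_smoothAt (h : IsEmbeddedData D S φ O ζ) (x : N) :
    ContMDiffAt (𝓡 m) (𝓡 (m + 1)) ∞ φ x := h.embedding.isImmersion.contMDiff x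

lemma φ_mdifferentiableAt (h : IsEmbeddedData D S φ O ζ) (x : N) :
    MDifferentiableAt (𝓡 m) (𝓡 (m + 1)) φ x := (h.φ_smoothAt x).mdifferentiableAt (by simp)

lemma rigging_smoothAt (h : IsEmbeddedData D S φ O ζ) (x : N) : VecField.SmoothAt ζ (φ x) :=
  ContMDiffOn.contMDiffAt h.rigging_smooth (h.isOpen.mem_nhds (h.range_subset ⟨x, rfl⟩))

/-- Vectors at a point of the hypersurface are equal if their products with the rigging and all
tangent vectors are. -/
lemma ext_vector (h : IsEmbeddedData D S φ O ζ) {V W : TangentSpace (𝓡 (m + 1)) (φ x)}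
    (h1 : S.g (φ x) V (ζ (φ x)) = S.g (φ x) W (ζ (φ x)))
    (h2 : ∀ u, S.g (φ x) V (mfderiv (𝓡 m) (𝓡 (m + 1)) φ x u) =
      S.g (φ x) W (mfderiv (𝓡 m) (𝓡 (m + 1)) φ x u)) : V = W := by
  refine S.flatMap_injective (φ x) (LinearMap.ext fun Z ↦ ?_)
  obtain ⟨⟨u, a⟩, rfl⟩ := (h.frameEquiv x).surjective Z
  rw [LorentzianMetric.flatMap_apply, LorentzianMetric.flatMap_apply, frameEquiv_apply]
  simp only [map_add, map_smul, h1, h2]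

/-- `φ_* n` has product `ℓ(n) = 1` with the rigging and `γ(n,·) = 0` with tangent vectors, which
characterizes `ν`. It turns the ambient scalar `w` into `q(n)`. -/
lemma nu_eq (h : IsEmbeddedData D S φ O ζ) (x : N) :
    h.nu x = mfderiv (𝓡 m) (𝓡 (m + 1)) φ x (D.n x) := by
  refine h.ext_vector ?_ fun u ↦ ?_
  · rw [nu, S.g_sharp, h.normalCovec_rigging, S.g_symm, h.pullback_g_rigging, D.ell_n]
  · rw [nu, S.g_sharp, h.normalCovec_tangent, h.pullback_g, D.γ_n]
    rfl

/-- A null vector field tangent to the hypersurface is the push-forward of `α n`, with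
`α = g(ζ,η)`. -/
lemma eq_mfderiv_of_null (h : IsEmbeddedData D S φ O ζ)
    (hnull : S.g (φ x) (η (φ x)) (η (φ x)) = 0)
    (htan : η (φ x) ∈ Set.range (mfderiv (𝓡 m) (𝓡 (m + 1)) φ x)) :
    η (φ x) = mfderiv (𝓡 m) (𝓡 (m + 1)) φ x (S.g (φ x) (ζ (φ x)) (η (φ x)) • D.n x) := by
  obtain ⟨u, hu⟩ := htan
  rw [← hu, h.pullback_g] at hnull
  rw [← hu, h.pullback_g_rigging, ← D.eq_smul_n_of_null hnull]

/-! ### The commutator `[η,ζ]` on the hypersurface -/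

section Commutator

/-- `g([η,ζ],·)` on the tangent vectors of the hypersurface. -/
lemma g_commutator_tangent (h : IsEmbeddedData D S φ O ζ) (hη : VecField.SmoothAt η (φ x))
    (he : VecField.SmoothAt etab x) (hηe : ∀ y, η (φ y) = mfderiv (𝓡 m) (𝓡 (m + 1)) φ y (etab y))
    (u : TangentSpace (𝓡 m) x) :
    S.g (φ x) (mlieBracket (𝓡 (m + 1)) η ζ (φ x)) (mfderiv (𝓡 m) (𝓡 (m + 1)) φ x u) =
      lieCovec etab D.ell x u - h.q η x u := by
  obtain ⟨X, X', hX, hX', rfl, hXX'⟩ := h.embedding.isImmersion.exists_related u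
  have hg := (g_smoothAt S (φ x)).diffAt
  have hζ := (h.rigging_smoothAt x).diffAt
  have e1 : h.q η x (X x) = lieBilin η S.g (φ x) (ζ (φ x)) (X' (φ x)) := by
    rw [hXX'.self_of_nhds]; rfl
  have e2 : mvfderiv (𝓡 (m + 1)) (fun y ↦ S.g y (ζ y) (X' y)) (φ x) (η (φ x)) =
      mvfderiv (𝓡 m) (fun y ↦ D.ell y (X y)) x (etab x) := by
    rw [hηe, ← mvfderiv_comp_apply' ((hg.apply hζ).apply hX'.diffAt) (h.φ_mdifferentiableAt x)]
    refine mvfderiv_congr_of_eventuallyEq ?_ _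
    filter_upwards [hXX'] with y hy
    rw [hy, h.pullback_g_rigging]
  -- Expand `(£_η g)(ζ,X')`: since `[η,X'] = φ_*[η̄,X]`, the terms other than the commutator
  -- assemble to `£_η̄ ℓ`.
  rw [e1, lieBilin_apply hg hζ hX'.diffAt, lieCovec_apply (D.ell_diffAt x) hX.diffAt, e2,
    mlieBracket_of_related (h.φ_smoothAt x) he hX hη hX' (.of_forall hηe) hXX',
    h.pullback_g_rigging, hXX'.self_of_nhds]
  ring

/-- `g([η,ζ],ζ)` on the hypersurface. -/
lemma g_commutator_rigging (h : IsEmbeddedData D S φ O ζ)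
    (hηe : ∀ y, η (φ y) = mfderiv (𝓡 m) (𝓡 (m + 1)) φ y (etab y)) (x : N) :
    S.g (φ x) (mlieBracket (𝓡 (m + 1)) η ζ (φ x)) (ζ (φ x)) =
      1 / 2 * (mvfderiv (𝓡 m) D.ell2 x (etab x) - h.p η x) := by
  have hg := (g_smoothAt S (φ x)).diffAt
  have hζ := (h.rigging_smoothAt x).diffAt
  have e1 : h.p η x = lieBilin η S.g (φ x) (ζ (φ x)) (ζ (φ x)) := rfl
  have e2 : mvfderiv (𝓡 (m + 1)) (fun y ↦ S.g y (ζ y) (ζ y)) (φ x) (η (φ x)) =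
      mvfderiv (𝓡 m) D.ell2 x (etab x) := by
    rw [hηe, ← mvfderiv_comp_apply' ((hg.apply hζ).apply hζ) (h.φ_mdifferentiableAt x)]
    exact congr(mvfderiv (𝓡 m) $(funext h.pullback_g_rigging_rigging) x (etab x))
  rw [e1, lieBilin_apply hg hζ hζ, e2, S.g_symm _ (ζ (φ x))]
  ring

lemma w_eq (h : IsEmbeddedData D S φ O ζ) (η : VecField (𝓡 (m + 1)) (M := M)) (x : N) :
    h.w η x = h.q η x (D.n x) := by
  rw [w, nu_eq]
  rfl

/-- `P` inverts `γ` up to the term `β(n) ℓ`, and for `β = £_η̄ ℓ - q` the number `β(n)` is `A_η`,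
because `w = q(n)`. -/
lemma γ_X (h : IsEmbeddedData D S φ O ζ) (η : VecField (𝓡 (m + 1)) (M := M))
    (etab : VecField (𝓡 m) (M := N)) (x : N) (u : TangentSpace (𝓡 m) x) :
    D.γ x (h.X η etab x) u =
      (lieCovec etab D.ell x - h.q η x) u - h.A η etab x * D.ell x u := by
  rw [X, map_add, map_smul, D.γ_n, smul_zero, zero_add, D.γ_P, A, w_eq]
  rfl

lemma ell_X (h : IsEmbeddedData D S φ O ζ) (η : VecField (𝓡 (m + 1)) (M := M))
    (etab : VecField (𝓡 m) (M := N)) (x : N) :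
    D.ell x (h.X η etab x) = 1 / 2 * (mvfderiv (𝓡 m) D.ell2 x (etab x) - h.p η x)
      - D.ell2 x * h.A η etab x := by
  rw [X, map_add, map_smul, D.ell_n, D.ell_P, A, w_eq]
  simp
  ring

/-- Both sides have the same products: with `ζ` the right side gives `A ℓ^{(2)} + ℓ(X)`, with
tangent vectors `A ℓ + γ(X,·)`, which `ell_X` and `γ_X` evaluate. -/
lemma commutator_eq (h : IsEmbeddedData D S φ O ζ) (hη : VecField.SmoothAt η (φ x))
    (he : VecField.SmoothAt etab x)
    (hηe : ∀ y, η (φ y) = mfderiv (𝓡 m) (𝓡 (m + 1)) φ y (etab y)) :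
    mlieBracket (𝓡 (m + 1)) η ζ (φ x) =
      h.A η etab x • ζ (φ x) + mfderiv (𝓡 m) (𝓡 (m + 1)) φ x (h.X η etab x) := by
  refine h.ext_vector ?_ fun u ↦ ?_
  · rw [h.g_commutator_rigging hηe, map_add, map_smul, add_apply, smul_apply,
      h.pullback_g_rigging_rigging, S.g_symm _ _ (ζ (φ x)), h.pullback_g_rigging, ell_X,
      smul_eq_mul]
    ring
  · rw [h.g_commutator_tangent hη he hηe, map_add, map_smul, add_apply, smul_apply,
      h.pullback_g_rigging, h.pullback_g, γ_X, smul_eq_mul, sub_apply]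
    ring

/-- The products of `ν` and `θ^a` with a vector are its components in the frame `{ζ, e_a}`, so the
coefficients are simply the products of the commutator with that frame. -/
lemma commutator_eq_dual (h : IsEmbeddedData D S φ O ζ) (hη : VecField.SmoothAt η (φ x))
    (he : VecField.SmoothAt etab x)
    (hηe : ∀ y, η (φ y) = mfderiv (𝓡 m) (𝓡 (m + 1)) φ y (etab y))
    (e : Basis (Fin m) ℝ (TangentSpace (𝓡 m) x)) :
    mlieBracket (𝓡 (m + 1)) η ζ (φ x) =
      (1 / 2 * (mvfderiv (𝓡 m) D.ell2 x (etab x) - h.p η x) : ℝ) • h.nu x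
      + ∑ a, (lieCovec etab D.ell x (e a) - h.q η x (e a)) • h.theta x e a := by
  have t1 (a) (Z) : S.g (φ x) (h.theta x e a) Z = (h.frame x e).coord (some a) Z := by
    rw [theta, S.g_sharp]
  refine h.ext_vector ?_ fun u ↦ ?_
  · rw [h.g_commutator_rigging hηe]
    simp only [map_add, map_smul, map_sum, add_apply, smul_apply, sum_apply, t1, nu, S.g_sharp,
      h.normalCovec_rigging]
    rw [← h.frame_none x e]
    simp
  · rw [h.g_commutator_tangent hη he hηe]
    simp only [map_add, map_smul, map_sum, add_apply, smul_apply, sum_apply, t1, nu, S.g_sharp,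
      h.normalCovec_tangent]
    have hu : ∀ a, (h.frame x e).coord (some a) (mfderiv (𝓡 m) (𝓡 (m + 1)) φ x u) = e.repr u a := by
      intro a
      have : (h.frame x e).coord (some a) ∘ₗ (mfderiv (𝓡 m) (𝓡 (m + 1)) φ x).toLinearMap =
          e.coord a := by
        refine e.ext fun b ↦ ?_
        rw [LinearMap.comp_apply, ContinuousLinearMap.coe_coe, ← h.frame_some x e b]
        simp [Finsupp.single_apply]
      exact congr($this u)
    simp only [hu]
    have h1 := congr((lieCovec etab D.ell x - h.q η x) $(e.sum_repr u))
    simp only [map_sum, map_smul, sub_apply] at h1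
    rw [← h1]
    simp [mul_comm]

end Commutator

/-! ### Smoothness of `q`, `A_η` and `X_η` -/

section Smoothness

lemma commutator_smoothAt (h : IsEmbeddedData D S φ O ζ) (hη : VecField.SmoothAt η (φ x)) :
    CovecField.SmoothAt (fun y ↦ S.g y (mlieBracket (𝓡 (m + 1)) η ζ y)) (φ x) :=
  (g_smoothAt S (φ x)).apply (hη.mlieBracket (h.rigging_smoothAt x))

/-- This covector field is the pull-back of `g([η,ζ],·)`, which is smooth near the hypersurface.
Smoothness of `q`, `A_η` and `X_η` is derived from it. -/
lemma lieCovec_sub_q_smoothAt (h : IsEmbeddedData D S φ O ζ)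
    (hη : ∀ x, VecField.SmoothAt η (φ x)) (he : ∀ x, VecField.SmoothAt etab x)
    (hηe : ∀ y, η (φ y) = mfderiv (𝓡 m) (𝓡 (m + 1)) φ y (etab y)) (x : N) :
    CovecField.SmoothAt (fun y ↦ lieCovec etab D.ell y - h.q η y) x := by
  refine CovecField.smoothAt_of_apply fun X hX ↦ ?_
  refine ((h.commutator_smoothAt (hη x)).contMDiffAt_pullback (h.φ_smoothAt x)
    hX).congr_of_eventuallyEq (.of_forall fun y ↦ ?_)
  exact (h.g_commutator_tangent (hη y) (he y) hηe (X y)).symm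

lemma q_smoothAt (h : IsEmbeddedData D S φ O ζ)
    (hη : ∀ x, VecField.SmoothAt η (φ x)) (he : ∀ x, VecField.SmoothAt etab x)
    (hηe : ∀ y, η (φ y) = mfderiv (𝓡 m) (𝓡 (m + 1)) φ y (etab y)) (x : N) :
    CovecField.SmoothAt (h.q η) x := by
  refine CovecField.smoothAt_of_apply fun X hX ↦ ?_
  have hl : CovecField.SmoothAt (lieCovec etab D.ell) x :=
    CovecField.SmoothAt.lieCovec (he x) (D.ell_smooth x)
  refine ((hl.apply hX).sub ((h.lieCovec_sub_q_smoothAt hη he hηe x).apply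
    hX)).congr_of_eventuallyEq (.of_forall fun y ↦ ?_)
  simp

lemma A_smoothAt (h : IsEmbeddedData D S φ O ζ)
    (hη : ∀ x, VecField.SmoothAt η (φ x)) (he : ∀ x, VecField.SmoothAt etab x)
    (hηe : ∀ y, η (φ y) = mfderiv (𝓡 m) (𝓡 (m + 1)) φ y (etab y)) (x : N) :
    ContMDiffAt (𝓡 m) 𝓘(ℝ) ∞ (h.A η etab) x := by
  refine ((h.lieCovec_sub_q_smoothAt hη he hηe x).apply (D.n_smoothAt x)).congr_of_eventuallyEq
    (.of_forall fun y ↦ ?_)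
  simp [A, w_eq]

lemma X_smoothAt (h : IsEmbeddedData D S φ O ζ)
    (hη : ∀ x, VecField.SmoothAt η (φ x)) (he : ∀ x, VecField.SmoothAt etab x)
    (hηe : ∀ y, η (φ y) = mfderiv (𝓡 m) (𝓡 (m + 1)) φ y (etab y)) (x : N) :
    VecField.SmoothAt (h.X η etab) x := by
  have hell : CovecField.SmoothAt D.ell x := D.ell_smooth x
  have hA := h.A_smoothAt hη he hηe x
  refine D.smoothAt_of_γ_ell (CovecField.smoothAt_of_apply fun Y hY ↦ ?_) ?_
  · refine (((h.lieCovec_sub_q_smoothAt hη he hηe x).apply hY).sub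
      (hA.mul (hell.apply hY))).congr_of_eventuallyEq (.of_forall fun y ↦ ?_)
    simp [γ_X]
  · have h1 : ContMDiffAt (𝓡 (m + 1)) 𝓘(ℝ) ∞
        (fun y ↦ S.g y (mlieBracket (𝓡 (m + 1)) η ζ y) (ζ y)) (φ x) :=
      (h.commutator_smoothAt (hη x)).apply (h.rigging_smoothAt x)
    refine ((h1.comp x (h.φ_smoothAt x)).sub
      ((D.ell2_smooth x).mul hA)).congr_of_eventuallyEq (.of_forall fun y ↦ ?_)
    refine (h.ell_X η etab y).trans ?_
    rw [← h.g_commutator_rigging hηe]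
    rfl

end Smoothness

/-! ### The Lie derivative of `Y`, first in commutator form and then expanded -/

section LieDerivativeOfY

lemma lieBilin_Y (h : IsEmbeddedData D S φ O ζ)
    (hη : ∀ x, VecField.SmoothAt η (φ x)) (he : ∀ x, VecField.SmoothAt etab x)
    (hηe : ∀ y, η (φ y) = mfderiv (𝓡 m) (𝓡 (m + 1)) φ y (etab y)) (x : N)
    (u v : TangentSpace (𝓡 m) x) :
    lieBilin etab D.Y x u v =
      h.A η etab x * D.Y x u v
      + 1 / 2 * (D.ell x u * mvfderiv (𝓡 m) (h.A η etab) x v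
          + mvfderiv (𝓡 m) (h.A η etab) x u * D.ell x v)
      + 1 / 2 * lieBilin (h.X η etab) D.γ x u v
      + h.II η x u v := by
  have hφ := h.embedding.isImmersion
  have hζ := h.rigging_smoothAt x
  have hg := g_smoothAt S (φ x)
  have hYd : BilinField.DiffAt D.Y x := (D.Y_smooth x).mdifferentiableAt (by simp)
  have hL := hg.lieBilin hζ
  have hLd : BilinField.DiffAt ((1 / 2 : ℝ) • lieBilin ζ S.g) (φ x) := by
    refine (BilinField.smoothAt_of_apply fun X Y hX hY ↦ ?_).diffAt
    exact contMDiffAt_const.mul ((hL.apply hX).apply hY)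
  -- `Y` is the pull-back of `½ £_ζ g` and `η` is related to `η̄`, so `£_η̄ Y` is the pull-back of
  -- `£_η(½ £_ζ g)`; `e2` takes the constant out.
  have e1 := lieBilin_pullback hφ hLd hYd h.pullback_lie (he x) (hη x) (.of_forall hηe) u v
  have e2 : lieBilin η ((1 / 2 : ℝ) • lieBilin ζ S.g) (φ x) (mfderiv (𝓡 m) (𝓡 (m + 1)) φ x u)
      (mfderiv (𝓡 m) (𝓡 (m + 1)) φ x v) = 1 / 2 * lieBilin η (lieBilin ζ S.g) (φ x)
        (mfderiv (𝓡 m) (𝓡 (m + 1)) φ x u) (mfderiv (𝓡 m) (𝓡 (m + 1)) φ x v) := by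
    obtain ⟨X, hX, hXu⟩ := VecField.exists_smoothAt (mfderiv (𝓡 m) (𝓡 (m + 1)) φ x u)
    obtain ⟨Y, hY, hYv⟩ := VecField.exists_smoothAt (mfderiv (𝓡 m) (𝓡 (m + 1)) φ x v)
    have hc : MDifferentiableAt (𝓡 (m + 1)) 𝓘(ℝ) (fun _ : M ↦ (1 / 2 : ℝ)) (φ x) :=
      mdifferentiableAt_const
    have k := mvfderiv_mul_apply hc ((hL.apply hX).apply hY |>.mdifferentiableAt (by simp))
      (η (φ x))
    rw [mvfderiv_const] at k
    rw [← hXu, ← hYv, lieBilin_apply hLd hX.diffAt hY.diffAt,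
      lieBilin_apply hL.diffAt hX.diffAt hY.diffAt]
    simp only [Pi.smul_apply, smul_apply, smul_eq_mul]
    rw [k]
    simp
    -- After the constant is taken out, exchanging `£_η` and `£_ζ` in `e3` produces `𝕴` and a
    -- commutator term, which `e4` evaluates on the hypersurface.
    ring
  have e3 := lieBilin_lieBilin_sub hg (hη x) hζ (mfderiv (𝓡 m) (𝓡 (m + 1)) φ x u)
    (mfderiv (𝓡 m) (𝓡 (m + 1)) φ x v)
  have e4 := lieBilin_pullback_of_eq_add hφ hg.diffAt (D.γ_diffAt x) h.pullback_g S.g_symm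
    hζ.diffAt ((hη x).mlieBracket hζ).diffAt (D.ell_diffAt x) h.pullback_g_rigging
    ((h.A_smoothAt hη he hηe x).mdifferentiableAt (by simp)) (h.X_smoothAt hη he hηe x).diffAt
    (fun y ↦ h.commutator_eq (hη y) (he y) hηe) u v
  have e5 := h.pullback_lie x u v
  have e6 : h.II η x u v = 1 / 2 * lieBilin ζ (lieBilin η S.g) (φ x)
    (mfderiv (𝓡 m) (𝓡 (m + 1)) φ x u) (mfderiv (𝓡 m) (𝓡 (m + 1)) φ x v) := rfl
  rw [← e1, e2, e6]
  linear_combination (1 / 2) * e3 + (1 / 2) * e4 + h.A η etab x * e5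

lemma lieBilin_Y_expanded (h : IsEmbeddedData D S φ O ζ) {α : N → ℝ}
    (hα : ∀ x, ContMDiffAt (𝓡 m) 𝓘(ℝ) ∞ α x)
    (hη : ∀ x, VecField.SmoothAt η (φ x))
    (hηe : ∀ y, η (φ y) = mfderiv (𝓡 m) (𝓡 (m + 1)) φ y (α y • D.n y)) (x : N)
    (u v : TangentSpace (𝓡 m) x) :
    lieBilin (fun y ↦ α y • D.n y) D.Y x u v =
      covDerivCovec D.metricConnection (mvfderiv (𝓡 m) α) x u v
      + 2 * α x * (1 / 2 * (covDerivCovec D.metricConnection D.s x u v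
          + covDerivCovec D.metricConnection D.s x v u))
      + 2 * (1 / 2 * (D.s x u * mvfderiv (𝓡 m) α x v + D.s x v * mvfderiv (𝓡 m) α x u))
      + mvfderiv (𝓡 m) α x (D.n x) * D.Y x u v
      + 1 / 2 * mvfderiv (𝓡 m) D.ell2 x (α x • D.n x) * D.U x u v
      - (1 / 2 * (covDerivCovec D.metricConnection (h.q η) x u v
            + covDerivCovec D.metricConnection (h.q η) x v u)
          + h.w η x * D.Y x u v + h.p η x / 2 * D.U x u v - h.II η x u v) := by
  have he (x) : VecField.SmoothAt (fun y ↦ α y • D.n y) x :=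
    VecField.SmoothAt.smul (hα x) (D.n_smoothAt x)
  have hαd (x) : MDifferentiableAt (𝓡 m) 𝓘(ℝ) α x := (hα x).mdifferentiableAt (by simp)
  have hq := (h.q_smoothAt hη he hηe x).diffAt
  have hβ := (h.lieCovec_sub_q_smoothAt hη he hηe x).diffAt
  -- From `£_{α n} ℓ = dα + 2 α s` evaluated on `n`, where `s(n) = 0`.
  have hA : h.A η (fun y ↦ α y • D.n y) x = mvfderiv (𝓡 m) α x (D.n x) - h.w η x := by
    rw [A, D.lieCovec_smul_n_ell (hαd x), D.s_n]
    ring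
  have key := D.half_lieBilin_γ (h.X_smoothAt hη he hηe x).diffAt hβ
    ((h.A_smoothAt hη he hηe x).mdifferentiableAt (by simp)) (h.γ_X η _) u v
  -- The derivative of `β = dα + 2 α s - q`. The product rule gives `2 dα ⊗ s`, and its
  -- symmetrization is the mixed term of the expanded identity.
  have hcov (u v : TangentSpace (𝓡 m) x) : covDerivCovec D.metricConnection
      (fun y ↦ lieCovec (fun y ↦ α y • D.n y) D.ell y - h.q η y) x u v =
      covDerivCovec D.metricConnection (mvfderiv (𝓡 m) α) x u v
      + 2 * α x * covDerivCovec D.metricConnection D.s x u v + 2 * mvfderiv (𝓡 m) α x u * D.s x v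
      - covDerivCovec D.metricConnection (h.q η) x u v := by
    obtain ⟨X, hX, rfl⟩ := VecField.exists_smoothAt u
    obtain ⟨Y, hY, rfl⟩ := VecField.exists_smoothAt v
    have hX := hX.diffAt
    have hY := hY.diffAt
    have hdα := (CovecField.smoothAt_mvfderiv (hα x)).diffAt
    have hs := (D.s_smoothAt x).diffAt
    have d0 : MDifferentiableAt (𝓡 m) 𝓘(ℝ) (fun y ↦ 2 * α y) x := mdifferentiableAt_const.mul (hαd x)
    have d1 : MDifferentiableAt (𝓡 m) 𝓘(ℝ) (fun y ↦ 2 * α y * D.s y (Y y)) x :=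
      d0.mul (hs.apply hY)
    have d2 : MDifferentiableAt (𝓡 m) 𝓘(ℝ)
      (fun y ↦ mvfderiv (𝓡 m) α y (Y y) + 2 * α y * D.s y (Y y)) x := (hdα.apply hY).add d1
    rw [covDerivCovec_apply hβ hX hY, covDerivCovec_apply hdα hX hY, covDerivCovec_apply hs hX hY,
      covDerivCovec_apply hq hX hY]
    have k2 := mvfderiv_mul_apply (mdifferentiableAt_const (c := (2 : ℝ))) (hαd x) (X x)
    rw [mvfderiv_const] at k2
    simp only [sub_apply, D.lieCovec_smul_n_ell (hαd _)]
    rw [mvfderiv_sub_apply d2 (hq.apply hY), mvfderiv_add_apply (hdα.apply hY) d1,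
      mvfderiv_mul_apply d0 (hs.apply hY), k2]
    simp only [zero_apply]
    ring
  -- The terms `ℓ ⊗_s dA` of `lieBilin_Y` and `key` cancel, and `ell_X` reduces `ℓ^{(2)} A + ℓ(X)`
  -- to `½ (η̄(ℓ^{(2)}) - p)`, the coefficient of `U`.
  rw [h.lieBilin_Y hη he hηe, key, hcov, hcov, D.covDerivCovec_mvfderiv_symm (hα x) v u, ell_X, hA]
  ring

end LieDerivativeOfY

end IsEmbeddedData

end

theorem theorem4p1 {m : ℕ}
    {N : Type*} [TopologicalSpace N] [ChartedSpace (EuclideanSpace ℝ (Fin m)) N]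
    [IsManifold (𝓡 m) ∞ N]
    {M : Type*} [TopologicalSpace M] [ChartedSpace (EuclideanSpace ℝ (Fin (m + 1))) M]
    [IsManifold (𝓡 (m + 1)) ∞ M]
    (D : NullHypersurfaceData m N) (S : LorentzianMetric m M) (φ : N → M)
    (O : Set M) (ζ : VecField (𝓡 (m + 1)) (M := M)) (h : IsEmbeddedData D S φ O ζ)
    (V : Set M) (hV : IsOpen V) (hφV : Set.range φ ⊆ V)
    (η : VecField (𝓡 (m + 1)) (M := M)) (hη : VecField.SmoothOn η V)
    (hη_null : ∀ x, S.g (φ x) (η (φ x)) (η (φ x)) = 0)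
    (hη_tangent : ∀ x, η (φ x) ∈ Set.range (mfderiv (𝓡 m) (𝓡 (m + 1)) φ x)) :
    ∃ (etab : VecField (𝓡 m) (M := N)) (α : N → ℝ),
      VecField.Smooth etab ∧ ContMDiff (𝓡 m) 𝓘(ℝ) ∞ α ∧
      (∀ x, η (φ x) = mfderiv (𝓡 m) (𝓡 (m + 1)) φ x (etab x)) ∧
      (∀ x, etab x = α x • D.n x) ∧
      ContMDiff (𝓡 m) 𝓘(ℝ) ∞ (h.A η etab) ∧ VecField.Smooth (h.X η etab) ∧
      -- the commutator `[η,ζ]` on `φ(N)`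
      (∀ x, mlieBracket (𝓡 (m + 1)) η ζ (φ x) =
        h.A η etab x • ζ (φ x) + mfderiv (𝓡 m) (𝓡 (m + 1)) φ x (h.X η etab x)) ∧
      (∀ (x : N) (e : Basis (Fin m) ℝ (TangentSpace (𝓡 m) x)),
        mlieBracket (𝓡 (m + 1)) η ζ (φ x) =
          (1 / 2 * (mvfderiv (𝓡 m) D.ell2 x (etab x) - h.p η x) : ℝ) • h.nu x
          + ∑ a, (lieCovec etab D.ell x (e a) - h.q η x (e a)) • h.theta x e a) ∧
      -- the identity for `£_η̄ Y`
      (∀ (x : N) (u v : TangentSpace (𝓡 m) x),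
        lieBilin etab D.Y x u v =
          h.A η etab x * D.Y x u v
          + 1 / 2 * (D.ell x u * mvfderiv (𝓡 m) (h.A η etab) x v
              + mvfderiv (𝓡 m) (h.A η etab) x u * D.ell x v)
          + 1 / 2 * lieBilin (h.X η etab) D.γ x u v
          + h.II η x u v) ∧
      -- its fully expanded form
      (∀ (x : N) (u v : TangentSpace (𝓡 m) x),
        lieBilin etab D.Y x u v =
          covDerivCovec D.metricConnection (mvfderiv (𝓡 m) α) x u v
          + 2 * α x * (1 / 2 * (covDerivCovec D.metricConnection D.s x u v
              + covDerivCovec D.metricConnection D.s x v u))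
          + 2 * (1 / 2 * (D.s x u * mvfderiv (𝓡 m) α x v + D.s x v * mvfderiv (𝓡 m) α x u))
          + mvfderiv (𝓡 m) α x (D.n x) * D.Y x u v
          + 1 / 2 * mvfderiv (𝓡 m) D.ell2 x (etab x) * D.U x u v
          - (1 / 2 * (covDerivCovec D.metricConnection (h.q η) x u v
                + covDerivCovec D.metricConnection (h.q η) x v u)
              + h.w η x * D.Y x u v + h.p η x / 2 * D.U x u v - h.II η x u v)) := by
  have hη' (x) : VecField.SmoothAt η (φ x) :=
    ContMDiffOn.contMDiffAt hη (hV.mem_nhds (hφV ⟨x, rfl⟩))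
  -- The only candidate: pairing `η = φ_*(α n)` with the rigging gives `α ℓ(n) = α`. In this form
  -- smoothness is immediate.
  let α : N → ℝ := fun x ↦ S.g (φ x) (ζ (φ x)) (η (φ x))
  have hα (x) : ContMDiffAt (𝓡 m) 𝓘(ℝ) ∞ α x :=
    (((IsEmbeddedData.g_smoothAt S (φ x)).apply (h.rigging_smoothAt x)).apply (hη' x)).comp x
      (h.φ_smoothAt x)
  have he (x) : VecField.SmoothAt (fun y ↦ α y • D.n y) x :=
    VecField.SmoothAt.smul (hα x) (D.n_smoothAt x)
  have hηe (x) : η (φ x) = mfderiv (𝓡 m) (𝓡 (m + 1)) φ x (α x • D.n x) :=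
    h.eq_mfderiv_of_null (hη_null x) (hη_tangent x)
  exact ⟨fun y ↦ α y • D.n y, α, he, hα, hηe, fun _ ↦ rfl, h.A_smoothAt hη' he hηe,
    h.X_smoothAt hη' he hηe, fun x ↦ h.commutator_eq (hη' x) (he x) hηe,
    fun x e ↦ h.commutator_eq_dual (hη' x) (he x) hηe e, h.lieBilin_Y hη' he hηe,
    h.lieBilin_Y_expanded hα hη' hηe⟩
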